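/- Let $k$ be a commutative ring containing $\mathbb{Q}$, let $A$ be an associative unital $k$-algebra, $K\subseteq A$ a $k$-subalgebra, $M$ an $A$-bimodule (on which $k$ acts symmetrically), and $\smalltriangledown\colon M\otimes_A M\to M$ an associative $A$-bimodule map. Write $E=A\oplus M$, $\overline{E}=E/K$, $\overline{A}=A/K$ and $\otimes=\otimes_K$; for a $K$-bimodule $V$ let $V\otimes:=V/[V,K]$. For $x,y\in A\cup M$ let $xy$ be the product of $A$ or the action of $A$ on $M$, with $xy:=0$ if $x,y\in M$, and let $x\smalltriangledown y:=0$ unless $x,y\in M$; extend both to $E$ bilinearly. **The modules $X_{vw}$.** For $v,w\ge 0$ and $n=v+w$, let $X_{vw}:=M\otimes B^n_w\otimes$, where $B^n_w\subseteq\overline{E}^{\otimes n}$ is spanned by the simple tensors $x_1\otimes\dots\otimes x_n$ with exactly $w$ of the $x_i$ in $M$ and the other ones in $\overline{A}$ (so that $X_{00}=M/[M,K]$); let $X_{vw}:=0$ if $v<0$ or $w<0$. For a tensor $\mathbf{x}=x_0\otimes\dots\otimes x_n$ of this kind put $$\mu_j(\mathbf{x})=(-1)^j x_0\otimes\dots\otimes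 x_jx_{j+1}\otimes\dots\otimes x_n\ (0\le j<n),\qquad \mu_n(\mathbf{x})=(-1)^n x_nx_0\otimes x_1\otimes\dots\otimes x_{n-1},$$ let $\varrho_j$ be given by the same formulas with $\smalltriangledown$ in place of the product, and $$t(\mathbf{x})=(-1)^{in}x_i\otimes\dots\otimes x_n\otimes x_0\otimes\dots\otimes x_{i-1},\qquad i=\max\{j: x_j\in M\}.$$ Let $b=\sum_{j=0}^n\mu_j\colon X_{vw}\to X_{v-1,w}$, $d'=\sum_{j=0}^{n-1}\varrho_j$ and $d=d'+\varrho_n\colon X_{vw}\to X_{v,w-1}$, and, on $X_{vw}$, $N=\sum_{l=0}^w t^l$ and $\sigma'=\sum_{j=0}^{w-1}\frac{w-j}{w+1}t^j$. **The quotients.** Let $\overline{X}_{vw}$ be the cokernel of $\mathrm{id}-t\colon X_{vw}\to X_{vw}$. The maps $b$, $d$, $N$ induce $\overline{b}\colon\overline{X}_{vw}\to\overline{X}_{v-1,w}$, $\overline{d}\colon\overline{X}_{vw}\to\overline{X}_{v,w-1}$ and $\overline{N}\colon\overline{X}_{vw}\to X_{vw}$. Let $\mathfrak{p}\colon X_{vw}\to\overline{X}_{vw}$,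 $\mathfrak{p}(x)=\frac1{w+1}[x]$. Let $\overline{\xi}\colon\overline{X}_{vw}\to\overline{X}_{v,w-2}$ be $\frac{1}{w+1}\,\mathfrak{p}\circ d'\circ\sigma'\circ d\circ\overline{N}$ if $w>1$, and $0$ if $w\le1$. For $t$-invariant $x\in X_{vw}$ let $\Upsilon(x)=(-\mathrm{id}+\overline{N}\circ\mathfrak{p})\circ\sigma'\circ d\,(x)\in X_{v,w-1}$ if $w>0$, and $\Upsilon(x)=0$ if $w=0$. **Double mixed complexes.** A double mixed complex is a bigraded $k$-module with $k$-linear maps $b$ of bidegree $(-1,0)$, $\beta$ of bidegree $(0,-1)$ and $B$ of bidegree $(0,1)$ such that $b^2=\beta^2=B^2=\beta b+b\beta=\beta B+B\beta=bB+Bb=0$; a morphism is a family of $k$-linear maps of bidegree $(0,0)$ commuting with $b$, $\beta$ and $B$. **The harmonic part.** For $v,w\ge0$ let $\ddot{X}_{vw}=X_{vw}\oplus X_{v,w-1}$, with $$\ddot{b}(x,y)=(b(x),-b(y)),\quad \ddot{d}(x,y)=(d(x)+(\mathrm{id}-t)(y),-d'(y)),\quad \ddot{B}(x,y)=(0,N(x))\in\ddot{X}_{v,w+1},$$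 and let $\ddot{\kappa}(x,y)=(t(x),\,t(y)+d'(x)-d(x))$ be the Karoubi operator. Let $P$ be the projection of $\ddot{X}_{vw}$ onto $\ker(\ddot{\kappa}-\mathrm{id})^2$ along $\operatorname{im}(\ddot{\kappa}-\mathrm{id})^2$. **Theorem.** For $v,w\ge0$ let $\widetilde{X}_{vw}=\overline{X}_{vw}\oplus\overline{X}_{v,w-1}$, with $$\widetilde{b}(x,y)=(\overline{b}(x),-\overline{b}(y)),\quad \widetilde{d}(x,y)=(\overline{d}(x),-\overline{d}(y)),\quad \widetilde{\xi}(x,y)=(0,\overline{\xi}(x)),\quad \widetilde{B}(x,y)=(0,x)\in\widetilde{X}_{v,w+1}.$$ Then 1. $(\widetilde{X},\widetilde{b},\widetilde{d}+\widetilde{\xi},\widetilde{B})$ is a double mixed complex; 2. $\ddot{X}_{vw}=\ker(\ddot{\kappa}-\mathrm{id})^2\oplus\operatorname{im}(\ddot{\kappa}-\mathrm{id})^2$ for all $v,w\ge 0$ (so that $P$ is defined), $P(\ddot{X})$ is stable under $\ddot{b}$, $\ddot{d}$ and $\ddot{B}$, and $(P(\ddot{X}),\ddot{b},\ddot{d},\ddot{B})$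 is a double mixed complex; 3. the maps $$\Psi_{vw}(x,y)=\frac1{w+1}\bigl(\overline{N}(x),\,\Upsilon(\overline{N}(x))\bigr)+\bigl(0,\overline{N}(y)\bigr)$$ take values in $P(\ddot{X}_{vw})$ and form an isomorphism of double mixed complexes $\Psi\colon(\widetilde{X},\widetilde{b},\widetilde{d}+\widetilde{\xi},\widetilde{B})\to(P(\ddot{X}),\ddot{b},\ddot{d},\ddot{B})$. -/

import Mathlib

set_option linter.unusedSectionVars false

open scoped TensorProduct

namespace CleftExt

noncomputable section

section Words

variable {E : Type*}

/-- Merging of letter `j` of a word `x₀ ⋯ x_{L+1}` with the cyclically next letter, by means of a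
product `f`: for `j ≤ L` the result is `x₀ ⋯ x_{j-1} f(x_j, x_{j+1}) x_{j+2} ⋯ x_{L+1}`, and for
`j = L + 1` it is `f(x_{L+1}, x₀) x₁ ⋯ x_L`. -/
def faceWord (f : E → E → E) {L : ℕ} (j : Fin (L + 2)) (x : Fin (L + 2) → E) :
    Fin (L + 1) → E := fun i =>
  if j = Fin.last (L + 1) then
    (if i = 0 then f (x (Fin.last (L + 1))) (x 0) else x i.castSucc)
  else
    (if i.val < j.val then x i.castSucc
     else if i.val = j.val then f (x i.castSucc) (x i.succ) else x i.succ)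

/-- The slot of the merged word which receives the `l`-th letter. -/
def slot {L : ℕ} (j l : Fin (L + 2)) : Fin (L + 1) :=
  if h : j.val = L + 1 then (if h' : l.val = L + 1 then 0 else ⟨l.val, by omega⟩)
  else if h' : l.val ≤ j.val then ⟨l.val, by omega⟩ else ⟨l.val - 1, by omega⟩

theorem slot_val {L : ℕ} (j l : Fin (L + 2)) : (slot j l).val =
    if j.val = L + 1 then (if l.val = L + 1 then 0 else l.val)
    else if l.val ≤ j.val then l.val else l.val - 1 := by
  unfold slot; split_ifs <;> rfl

theorem rot_val {n : ℕ} (i : Fin (n + 1)) :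
    (finRotate (n + 1) i).val = if i.val = n then 0 else i.val + 1 := by
  rw [coe_finRotate]; simp [Fin.ext_iff]

theorem rot_pow_val {L : ℕ} (i : ℕ) (l : Fin L) :
    (((finRotate L) ^ i) l).val = (l.val + i) % L := by
  obtain _ | n := L
  · exact l.elim0
  induction i with
  | zero => simp [Nat.mod_eq_of_lt l.isLt]
  | succ i ih =>
    have h : (l.val + i) % (n + 1) < n + 1 := Nat.mod_lt _ (by omega)
    rw [pow_succ', Equiv.Perm.mul_apply, rot_val, ih, ← add_assoc, Nat.add_mod (l.val + i) 1]
    split_ifs with h'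
    · rw [h']; obtain _ | n := n <;> simp
    · obtain _ | n := n
      · omega
      · rw [Nat.mod_eq_of_lt (a := 1) (by omega),
          Nat.mod_eq_of_lt (a := (l.val + i) % (n + 1 + 1) + 1) (by omega)]

theorem rot_pow_val' {L : ℕ} (i : ℕ) (l : Fin L) (hi : i ≤ L) :
    (((finRotate L) ^ i) l).val = if l.val + i < L then l.val + i else l.val + i - L := by
  rw [rot_pow_val]
  split_ifs with h
  · exact Nat.mod_eq_of_lt h
  · rw [Nat.mod_eq_sub_mod (by omega), Nat.mod_eq_of_lt (by omega)]

theorem rot_ne {L : ℕ} (j : Fin (L + 2)) : finRotate _ j ≠ j := by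
  rw [ne_eq, Fin.ext_iff, rot_val]; split_ifs <;> omega

theorem slot_surj {L : ℕ} (j : Fin (L + 2)) (i : Fin (L + 1)) : ∃ l, slot j l = i := by
  by_cases h : i.val ≤ j.val
  · exact ⟨i.castSucc, by
      have := i.isLt
      rw [Fin.ext_iff, slot_val, Fin.val_castSucc]; split_ifs <;> omega⟩
  · exact ⟨i.succ, by
      have := i.isLt
      have := j.isLt
      rw [Fin.ext_iff, slot_val, Fin.val_succ]; split_ifs <;> omega⟩

theorem slot_rot_self {L : ℕ} (j : Fin (L + 2)) : slot j (finRotate _ j) = slot j j := by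
  rw [Fin.ext_iff, slot_val, slot_val, rot_val]; split_ifs <;> omega

theorem slot_inj {L : ℕ} {j l l' : Fin (L + 2)} (h : slot j l = slot j l')
    (hl : l ≠ finRotate _ j) (hl' : l' ≠ finRotate _ j) : l = l' := by
  rw [ne_eq, Fin.ext_iff, rot_val] at hl hl'
  rw [Fin.ext_iff, slot_val, slot_val] at h
  rw [Fin.ext_iff]
  split_ifs at * <;> omega

theorem slot_rot {L : ℕ} {j l : Fin (L + 2)} (h : l ≠ j) :
    slot j (finRotate _ l) = finRotate _ (slot j l) := by
  rw [ne_eq, Fin.ext_iff] at h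
  rw [Fin.ext_iff, slot_val, rot_val, rot_val, slot_val]
  split_ifs at * <;> omega

theorem faceWord_self (f : E → E → E) {L : ℕ} (j : Fin (L + 2)) (x : Fin (L + 2) → E) :
    faceWord f j x (slot j j) = f (x j) (x (finRotate _ j)) := by
  have hs := slot_val j j
  have hr := rot_val j
  by_cases h : j = Fin.last (L + 1)
  · subst h
    have h0 : slot (Fin.last (L + 1)) (Fin.last (L + 1)) = 0 := by
      rw [Fin.ext_iff, hs]; simp
    rw [h0, finRotate_last]; simp [faceWord]
  · have h' : j.val ≠ L + 1 := fun e => h (Fin.ext (by simpa using e))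
    have e1 : (slot j j).castSucc = j := Fin.ext (by simp [hs, h'])
    have e2 : (slot j j).succ = finRotate _ j := Fin.ext (by rw [Fin.val_succ, hs, hr]; simp [h'])
    simp only [faceWord, if_neg h]
    rw [if_neg (by rw [hs]; simp [h']), if_pos (by rw [hs]; simp [h']), e1, e2]

theorem faceWord_of_ne (f : E → E → E) {L : ℕ} {j l : Fin (L + 2)} (x : Fin (L + 2) → E)
    (h1 : l ≠ j) (h2 : l ≠ finRotate _ j) : faceWord f j x (slot j l) = x l := by
  have hs := slot_val j l
  have hl := l.isLt
  have hj := j.isLt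
  rw [ne_eq, Fin.ext_iff] at h1 h2
  rw [rot_val] at h2
  by_cases h : j = Fin.last (L + 1)
  · subst h
    simp only [Fin.val_last] at *
    simp only [faceWord, if_true]
    have e1 : (slot (Fin.last (L + 1)) l).castSucc = l := Fin.ext (by
      simp [hs]; omega)
    rw [if_neg (by rw [Fin.ext_iff, hs]; simp; simp at h2; omega), e1]
  · have h' : j.val ≠ L + 1 := fun e => h (Fin.ext (by simpa using e))
    rw [if_neg h'] at h2 hs
    simp only [faceWord, if_neg h]
    by_cases hlt : l.val < j.val
    · have e1 : (slot j l).castSucc = l := Fin.ext (by simp [hs]; omega)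
      rw [if_pos (by rw [hs]; split_ifs <;> omega), e1]
    · have e1 : (slot j l).succ = l := Fin.ext (by simp [hs]; split_ifs <;> omega)
      rw [if_neg (by rw [hs]; split_ifs <;> omega), if_neg (by rw [hs]; split_ifs <;> omega), e1]

theorem eq_faceWord_iff {f : E → E → E} {L : ℕ} {j : Fin (L + 2)} {x : Fin (L + 2) → E}
    {y : Fin (L + 1) → E} : y = faceWord f j x ↔
    y (slot j j) = f (x j) (x (finRotate _ j)) ∧
      ∀ l, l ≠ j → l ≠ finRotate _ j → y (slot j l) = x l := by
  constructor
  · rintro rfl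
    exact ⟨faceWord_self f j x, fun l => faceWord_of_ne f x⟩
  · rintro ⟨h1, h2⟩
    funext i
    obtain ⟨l, rfl⟩ := slot_surj j i
    by_cases hl : l = j
    · subst hl; rw [h1, faceWord_self]
    by_cases hl' : l = finRotate _ j
    · subst hl'; rw [slot_rot_self, h1, faceWord_self]
    · rw [h2 l hl hl', faceWord_of_ne f x hl hl']

/-- Merging after a change of one letter. -/
theorem faceWord_update (f : E → E → E) {L : ℕ} (j l : Fin (L + 2)) (x : Fin (L + 2) → E) (a : E) :
    faceWord f j (Function.update x l a) = Function.update (faceWord f j x) (slot j l)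
      (if l = j then f a (x (finRotate _ j)) else if l = finRotate _ j then f (x j) a else a) := by
  symm
  rw [eq_faceWord_iff]
  constructor
  · by_cases h1 : l = j
    · subst h1
      rw [if_pos rfl, Function.update_self, Function.update_self, Function.update_of_ne (rot_ne l)]
    by_cases h2 : l = finRotate _ j
    · subst h2
      rw [slot_rot_self, Function.update_self, Function.update_self, if_neg (rot_ne j), if_pos rfl,
        Function.update_of_ne (rot_ne j).symm]
    · rw [Function.update_of_ne, Function.update_of_ne (Ne.symm h1), Function.update_of_ne (Ne.symm h2),
        faceWord_self]
      intro h
      exact h1 (slot_inj h (rot_ne j).symm h2).symm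
  · intro l' h1 h2
    by_cases h : l' = l
    · subst h; rw [if_neg h1, if_neg h2, Function.update_self, Function.update_self]
    · rw [Function.update_of_ne h]
      by_cases h3 : l = finRotate _ j
      · subst h3
        rw [slot_rot_self, Function.update_of_ne, faceWord_of_ne f x h1 h2]
        intro h'
        exact h1 (slot_inj h' h2 (rot_ne j).symm)
      · rw [Function.update_of_ne, faceWord_of_ne f x h1 h2]
        intro h'
        exact h (slot_inj h' h2 h3)

/-- Merging in a rotated word, when the position does not pass the end of the word. -/
theorem faceWord_rot_of_le (f : E → E → E) {L : ℕ} (i : ℕ) (j j' : Fin (L + 2)) (x : Fin (L + 2) → E)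
    (h : j'.val = j.val + i) :
    faceWord f j (x ∘ ⇑(finRotate (L + 2) ^ i)) = faceWord f j' x ∘ ⇑(finRotate (L + 1) ^ i) := by
  have hj' := j'.isLt
  have hj : (finRotate (L + 2) ^ i) j = j' := Fin.ext (by rw [rot_pow_val' _ _ (by omega)]; split_ifs <;> omega)
  have key : ∀ l, (finRotate (L + 1) ^ i) (slot j l) = slot j' ((finRotate (L + 2) ^ i) l) := by
    intro l
    have hl := l.isLt
    rw [Fin.ext_iff, rot_pow_val' _ _ (by omega), slot_val, slot_val, rot_pow_val' _ _ (by omega)]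
    split_ifs <;> omega
  have hc : ∀ l, (finRotate (L + 2) ^ i) (finRotate _ l) = finRotate _ ((finRotate (L + 2) ^ i) l) := by
    intro l; rw [← Equiv.Perm.mul_apply, ← Equiv.Perm.mul_apply, ← pow_succ, ← pow_succ']
  symm
  rw [eq_faceWord_iff]
  simp only [Function.comp_apply, key, hc, hj]
  refine ⟨faceWord_self f j' x, fun l h1 h2 => faceWord_of_ne f x ?_ ?_⟩
  · rw [← hj]; simpa using h1
  · rw [← hj, ← hc]; simpa using h2

/-- Merging in a rotated word, when the position passes the end of the word. -/
theorem faceWord_rot_of_lt (f : E → E → E) {L : ℕ} (i : ℕ) (j j' : Fin (L + 2)) (x : Fin (L + 2) → E)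
    (h : j'.val + (L + 2) = j.val + i) (hi : i ≤ L + 2) :
    faceWord f j (x ∘ ⇑(finRotate (L + 2) ^ i)) =
      faceWord f j' x ∘ ⇑(finRotate (L + 1) ^ (i - 1)) := by
  have hj1 := j.isLt
  have hj' := j'.isLt
  have hj : (finRotate (L + 2) ^ i) j = j' := Fin.ext (by rw [rot_pow_val' _ _ (by omega)]; split_ifs <;> omega)
  have key : ∀ l, (finRotate (L + 1) ^ (i - 1)) (slot j l) = slot j' ((finRotate (L + 2) ^ i) l) := by
    intro l
    have hl := l.isLt
    rw [Fin.ext_iff, rot_pow_val' _ _ (by omega), slot_val, slot_val, rot_pow_val' _ _ (by omega)]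
    split_ifs <;> omega
  have hc : ∀ l, (finRotate (L + 2) ^ i) (finRotate _ l) = finRotate _ ((finRotate (L + 2) ^ i) l) := by
    intro l; rw [← Equiv.Perm.mul_apply, ← Equiv.Perm.mul_apply, ← pow_succ, ← pow_succ']
  symm
  rw [eq_faceWord_iff]
  simp only [Function.comp_apply, key, hc, hj]
  refine ⟨faceWord_self f j' x, fun l h1 h2 => faceWord_of_ne f x ?_ ?_⟩
  · rw [← hj]; simpa using h1
  · rw [← hj, ← hc]; simpa using h2

end Words

section Tensors

variable (k A M : Type*) [CommRing k] [Ring A] [Algebra k A] [AddCommGroup M] [Module k M]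
  [Module A M] [Module Aᵐᵒᵖ M] [SMulCommClass A Aᵐᵒᵖ M] [IsScalarTower k A M]
  [IsScalarTower k Aᵐᵒᵖ M]

/-- An associative `A`-bimodule map `▽ : M ⊗_A M → M`, given as an `A`-balanced bilinear map. -/
structure BimoduleMul where
  /-- the underlying `k`-bilinear map `(m, m') ↦ m ▽ m'` -/
  op : M →ₗ[k] M →ₗ[k] M
  smul_op : ∀ (a : A) (m m' : M), op (a • m) m' = a • op m m'
  op_smul : ∀ (a : A) (m m' : M), op m (MulOpposite.op a • m') = MulOpposite.op a • op m m'
  balanced : ∀ (a : A) (m m' : M), op (MulOpposite.op a • m) m' = op m (a • m')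
  assoc : ∀ m m' m'' : M, op (op m m') m'' = op m (op m' m'')

/-- The `L`-fold tensor power over `k` of the module `E = A ⊕ M`. `TrivSqZeroExt A M` is `A × M`
with the product `(a, m)(a', m') = (aa', am' + ma')`; this is the product written `xy` (letters of
`M` multiply to zero), the product `▽` of letters of `M` is treated separately. -/
abbrev Ten (L : ℕ) : Type _ := ⨂[k] (_ : Fin L), TrivSqZeroExt A M

variable {k A} (K : Subalgebra k A)

/-- The relations of the cyclic tensor product over `K`:
`⋯ x_i c ⊗ x_{i+1} ⋯ = ⋯ x_i ⊗ c x_{i+1} ⋯` for `c ∈ K`, where `finRotate L i` is the cyclic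
successor of `i`, so that the last letter is also balanced against the letter `x₀`. -/
def balancing (L : ℕ) : Submodule k (Ten k A M L) :=
  Submodule.span k {z | ∃ (x : Fin L → TrivSqZeroExt A M) (i : Fin L) (c : A), c ∈ K ∧
    z = PiTensorProduct.tprod k (Function.update x i (x i * TrivSqZeroExt.inl c)) -
      PiTensorProduct.tprod k
        (Function.update x (finRotate L i) (TrivSqZeroExt.inl c * x (finRotate L i)))}

/-- The span of the words having a letter, other than `x₀`, in `K`. -/
def degenerate (L : ℕ) : Submodule k (Ten k A M L) :=
  Submodule.span k {z | ∃ (x : Fin L → TrivSqZeroExt A M) (i : Fin L) (c : A), c ∈ K ∧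
    i.val ≠ 0 ∧ x i = TrivSqZeroExt.inl c ∧ z = PiTensorProduct.tprod k x}

/-- `E ⊗ Ē ⊗ ⋯ ⊗ Ē ⊗` with `L` tensor factors: the cyclic tensor product over `K` of `E` with
`L - 1` copies of the `K`-bimodule `Ē = E / K`. -/
abbrev Cyc (L : ℕ) : Type _ := Ten k A M L ⧸ (balancing M K L ⊔ degenerate M K L)

variable {M}

/-- The class of the word `x₀ ⊗ ⋯ ⊗ x_{L-1}`. -/
def cls {L : ℕ} (x : Fin L → TrivSqZeroExt A M) : Cyc M K L :=
  (balancing M K L ⊔ degenerate M K L).mkQ (PiTensorProduct.tprod k x)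

variable {K}

theorem cls_balance {L : ℕ} (x : Fin L → TrivSqZeroExt A M) (i : Fin L) {c : A} (hc : c ∈ K) :
    cls K (Function.update x i (x i * TrivSqZeroExt.inl c)) =
      cls K (Function.update x (finRotate L i) (TrivSqZeroExt.inl c * x (finRotate L i))) := by
  rw [cls, cls, ← sub_eq_zero, ← map_sub, Submodule.mkQ_apply, Submodule.Quotient.mk_eq_zero]
  exact Submodule.mem_sup_left (Submodule.subset_span ⟨x, i, c, hc, rfl⟩)

theorem cls_degenerate {L : ℕ} (x : Fin L → TrivSqZeroExt A M) (i : Fin L) {c : A} (hc : c ∈ K)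
    (hi : i.val ≠ 0) (hx : x i = TrivSqZeroExt.inl c) : cls K x = 0 := by
  rw [cls, Submodule.mkQ_apply, Submodule.Quotient.mk_eq_zero]
  exact Submodule.mem_sup_right (Submodule.subset_span ⟨x, i, c, hc, hi, hx, rfl⟩)

theorem cls_eq_zero {L : ℕ} (x : Fin L → TrivSqZeroExt A M) (i : Fin L) (hx : x i = 0) :
    cls K x = 0 := by
  rw [cls, (PiTensorProduct.tprod k).map_coord_zero i hx, map_zero]

/-- Maps out of `Cyc` agree when they agree on words. -/
theorem cyc_ext {L : ℕ} {V : Type*} [AddCommGroup V] [Module k V] {f g : Cyc M K L →ₗ[k] V}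
    (h : ∀ x, f (cls K x) = g (cls K x)) : f = g := by
  apply Submodule.linearMap_qext
  apply PiTensorProduct.ext
  ext x
  exact h x

/-- Criterion for a map to be well defined on `Cyc`. -/
theorem le_comap {L : ℕ} {V : Type*} [AddCommGroup V] [Module k V] (f : Ten k A M L →ₗ[k] V)
    (h1 : ∀ (x : Fin L → TrivSqZeroExt A M) (i : Fin L) (c : A), c ∈ K →
      f (PiTensorProduct.tprod k (Function.update x i (x i * TrivSqZeroExt.inl c))) =
      f (PiTensorProduct.tprod k
        (Function.update x (finRotate L i) (TrivSqZeroExt.inl c * x (finRotate L i)))))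
    (h2 : ∀ (x : Fin L → TrivSqZeroExt A M) (i : Fin L) (c : A), c ∈ K → i.val ≠ 0 →
      x i = TrivSqZeroExt.inl c → f (PiTensorProduct.tprod k x) = 0) :
    balancing M K L ⊔ degenerate M K L ≤ LinearMap.ker f := by
  refine sup_le (Submodule.span_le.2 ?_) (Submodule.span_le.2 ?_)
  · rintro _ ⟨x, i, c, hc, rfl⟩
    simp only [SetLike.mem_coe, LinearMap.mem_ker, map_sub, h1 x i c hc, sub_self]
  · rintro _ ⟨x, i, c, hc, hi, hx, rfl⟩
    exact h2 x i c hc hi hx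

variable (k A M)

/-- The projection of `A ⊕ M` onto `A`, followed by the inclusion. -/
def projA : TrivSqZeroExt A M →ₗ[k] TrivSqZeroExt A M where
  toFun x := TrivSqZeroExt.inl x.fst
  map_add' x y := by ext <;> simp
  map_smul' r x := by ext <;> simp

/-- The projection of `A ⊕ M` onto `M`, followed by the inclusion. -/
def projM : TrivSqZeroExt A M →ₗ[k] TrivSqZeroExt A M where
  toFun x := TrivSqZeroExt.inr x.snd
  map_add' x y := by ext <;> simp
  map_smul' r x := by ext <;> simp

variable {k A M}

/-- The map `▽` extended by zero to `A ⊕ M`: `(a, m) ▽ (a', m') = (0, m ▽ m')`. -/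
def nabla (D : BimoduleMul k A M) :
    TrivSqZeroExt A M →ₗ[k] TrivSqZeroExt A M →ₗ[k] TrivSqZeroExt A M :=
  LinearMap.mk₂ k (fun x y => TrivSqZeroExt.inr (D.op x.snd y.snd))
    (fun x y z => by ext <;> simp) (fun r x y => by ext <;> simp)
    (fun x y z => by ext <;> simp) (fun r x y => by ext <;> simp)

@[simp] theorem nabla_apply (D : BimoduleMul k A M) (x y : TrivSqZeroExt A M) :
    nabla D x y = TrivSqZeroExt.inr (D.op x.snd y.snd) := rfl

/-- Compatibility of a product on `A ⊕ M` with the action of `A`. -/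
structure IsBalanced (f : TrivSqZeroExt A M →ₗ[k] TrivSqZeroExt A M →ₗ[k] TrivSqZeroExt A M) :
    Prop where
  mid : ∀ (c : A) x y, f (x * TrivSqZeroExt.inl c) y = f x (TrivSqZeroExt.inl c * y)
  left : ∀ (c : A) x y, f (TrivSqZeroExt.inl c * x) y = TrivSqZeroExt.inl c * f x y
  right : ∀ (c : A) x y, f x (y * TrivSqZeroExt.inl c) = f x y * TrivSqZeroExt.inl c

theorem isBalanced_mul : IsBalanced (LinearMap.mul k (TrivSqZeroExt A M)) where
  mid c x y := by simp [mul_assoc]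
  left c x y := by simp [mul_assoc]
  right c x y := by simp [mul_assoc]

theorem isBalanced_nabla (D : BimoduleMul k A M) : IsBalanced (nabla D) where
  mid c x y := by ext <;> simp [D.balanced]
  left c x y := by ext <;> simp [D.smul_op]
  right c x y := by ext <;> simp [D.op_smul]

section Faces

variable (f : TrivSqZeroExt A M →ₗ[k] TrivSqZeroExt A M →ₗ[k] TrivSqZeroExt A M)

/-- `faceWord` as a multilinear map into the tensor power. -/
def faceMulti {L : ℕ} (j : Fin (L + 2)) :
    MultilinearMap k (fun _ : Fin (L + 2) => TrivSqZeroExt A M) (Ten k A M (L + 1)) where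
  toFun x := PiTensorProduct.tprod k (faceWord (fun a b => f a b) j x)
  map_update_add' {inst} x l a b := by
    rw [Subsingleton.elim inst (instDecidableEqFin _)]
    simp only [faceWord_update]
    split_ifs <;> simp [MultilinearMap.map_update_add]
  map_update_smul' {inst} x l r a := by
    rw [Subsingleton.elim inst (instDecidableEqFin _)]
    simp only [faceWord_update]
    split_ifs <;> simp [MultilinearMap.map_update_smul]

/-- Merging of letter `j` with the cyclically next one, on tensors. On words with just one letter
nothing can be merged; the map is then zero. -/
def face : {L : ℕ} → Fin (L + 1) → Ten k A M (L + 1) →ₗ[k] Ten k A M L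
  | 0, _ => 0
  | _ + 1, j => PiTensorProduct.lift (faceMulti f j)

theorem face_tprod {L : ℕ} (j : Fin (L + 2)) (x : Fin (L + 2) → TrivSqZeroExt A M) :
    face f j (PiTensorProduct.tprod k x) =
      PiTensorProduct.tprod k (faceWord (fun a b => f a b) j x) := by
  simp [face, faceMulti]

variable {f}

theorem cls_face_balance (hf : IsBalanced f) {L : ℕ} (j : Fin (L + 2))
    (x : Fin (L + 2) → TrivSqZeroExt A M) (i : Fin (L + 2)) {c : A} (hc : c ∈ K) :
    cls K (faceWord (fun a b => f a b) j (Function.update x i (x i * TrivSqZeroExt.inl c))) =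
      cls K (faceWord (fun a b => f a b) j
        (Function.update x (finRotate _ i) (TrivSqZeroExt.inl c * x (finRotate _ i)))) := by
  rw [faceWord_update, faceWord_update]
  by_cases hi : i = j
  · subst hi
    rw [if_pos rfl, if_neg (rot_ne i), if_pos rfl, slot_rot_self, hf.mid]
  · have hr : finRotate _ i ≠ finRotate _ j := fun h => hi ((finRotate _).injective h)
    rw [if_neg hi, if_neg hr, slot_rot hi]
    convert cls_balance (faceWord (fun a b => f a b) j x) (slot j i) hc using 3
    · split_ifs with h
      · subst h
        rw [slot_rot_self, faceWord_self, hf.right]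
      · rw [faceWord_of_ne _ _ hi h]
    · rw [← slot_rot hi]
      split_ifs with h
      · rw [h, faceWord_self, hf.left]
      · rw [faceWord_of_ne _ _ h hr]

end Faces

theorem slot_ne_zero {L : ℕ} {j l : Fin (L + 2)} (h0 : l.val ≠ 0) (h1 : l ≠ j)
    (h2 : l ≠ finRotate _ j) : (slot j l).val ≠ 0 := by
  rw [ne_eq, Fin.ext_iff] at h1 h2
  rw [rot_val] at h2
  rw [slot_val]
  split_ifs at * <;> omega

/-- `ϱ_j`, with its sign: for a word of `n + 1` letters it is
`(-1)^j x₀ ⊗ ⋯ ⊗ (x_j ▽ x_{j+1}) ⊗ ⋯ ⊗ x_n` for `j < n`, and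
`(-1)^n (x_n ▽ x₀) ⊗ x₁ ⊗ ⋯ ⊗ x_{n-1}` for `j = n`. -/
def rho (D : BimoduleMul k A M) {L : ℕ} (j : Fin (L + 1)) : Cyc M K (L + 1) →ₗ[k] Cyc M K L :=
  Submodule.liftQ _ ((Submodule.mkQ _).comp ((-1 : k) ^ (j : ℕ) • face (nabla D) j)) (by
    obtain _ | L := L
    · rw [show face (nabla D) j = 0 from rfl]; simp
    apply le_comap
    · intro x i c hc
      simp only [LinearMap.comp_apply, LinearMap.smul_apply, map_smul, face_tprod]
      congr 1
      exact cls_face_balance (isBalanced_nabla D) j x i hc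
    · intro x i c hc hi hx
      simp only [LinearMap.comp_apply, LinearMap.smul_apply, map_smul, face_tprod]
      refine smul_eq_zero_of_right _ ?_
      by_cases h1 : i = j
      · subst h1
        exact cls_eq_zero _ (slot i i) (by rw [faceWord_self]; simp [hx])
      by_cases h2 : i = finRotate _ j
      · refine cls_eq_zero _ (slot j j) (by rw [faceWord_self, ← h2]; simp [hx])
      · exact cls_degenerate _ (slot j i) hc (slot_ne_zero hi h1 h2)
          (by rw [faceWord_of_ne _ _ h1 h2, hx]))

theorem rho_cls (D : BimoduleMul k A M) {L : ℕ} (j : Fin (L + 2))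
    (x : Fin (L + 2) → TrivSqZeroExt A M) :
    rho D j (cls K x) = (-1 : k) ^ (j : ℕ) • cls K (faceWord (fun a b => nabla D a b) j x) := by
  rw [rho, cls, Submodule.mkQ_apply, Submodule.liftQ_apply]
  simp only [LinearMap.comp_apply, LinearMap.smul_apply, map_smul, face_tprod]
  rfl

/-- The Hochschild boundary `∑ⱼ μⱼ`, where `μⱼ` merges the letters `j` and `j + 1` by the product
`xy`, with the sign `(-1)^j`. -/
def hoch {L : ℕ} : Cyc M K (L + 1) →ₗ[k] Cyc M K L :=
  Submodule.liftQ _ ((Submodule.mkQ _).comp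
    (∑ j : Fin (L + 1), (-1 : k) ^ (j : ℕ) • face (LinearMap.mul k (TrivSqZeroExt A M)) j)) (by
    obtain _ | L := L
    · simp [show ∀ j, face (L := 0) (LinearMap.mul k (TrivSqZeroExt A M)) j = 0 from fun _ => rfl]
    have key : ∀ (j : Fin (L + 2)) x, (balancing M K (L + 1) ⊔ degenerate M K (L + 1)).mkQ
        (face (LinearMap.mul k (TrivSqZeroExt A M)) j (PiTensorProduct.tprod k x)) =
        cls K (faceWord (fun a b => a * b) j x) := fun j x => by rw [face_tprod]; rfl
    apply le_comap
    · intro x i c hc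
      simp only [LinearMap.comp_apply, LinearMap.sum_apply, LinearMap.smul_apply, map_sum,
        map_smul, key]
      refine Finset.sum_congr rfl fun j _ => ?_
      congr 1
      exact cls_face_balance isBalanced_mul j x i hc
    · intro x i c hc hi hx
      simp only [LinearMap.comp_apply, LinearMap.sum_apply, LinearMap.smul_apply, map_sum,
        map_smul, key]
      obtain ⟨p, hp⟩ : ∃ p : Fin (L + 2), finRotate _ p = i := (finRotate _).surjective i
      have hpv : p.val + 1 = i.val := by
        have := rot_val p
        rw [hp] at this
        split_ifs at this <;> omega
      have hpi : p ≠ i := by rintro rfl; omega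
      rw [← Finset.sum_subset (Finset.subset_univ {p, i}), Finset.sum_pair hpi]
      · rw [← hpv, pow_succ, mul_neg_one, neg_smul, ← sub_eq_add_neg, ← smul_sub]
        refine smul_eq_zero_of_right _ (sub_eq_zero.2 ?_)
        have hil := i.isLt
        have e : finRotate (L + 1) (slot p p) = slot i i := by
          rw [Fin.ext_iff, rot_val, slot_val, slot_val]; split_ifs <;> omega
        have s1 : ∀ l, l ≠ i → slot p l = slot i l ∨ l = finRotate _ i := by
          intro l hl
          rw [ne_eq, Fin.ext_iff] at hl
          rw [Fin.ext_iff, slot_val, slot_val, Fin.ext_iff, rot_val]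
          split_ifs <;> omega
        have ha : finRotate (L + 1) (slot p p) = slot p (finRotate _ i) := by
          rw [slot_rot hpi.symm, ← hp, slot_rot_self]
        set z := Function.update (faceWord (fun a b => a * b) p x) (slot p p) (x p) with hz
        have hz' : ∀ l, l ≠ i → z (slot p l) = x l := by
          intro l hl
          by_cases hlp : l = p
          · subst hlp; rw [hz, Function.update_self]
          · rw [hz, Function.update_of_ne, faceWord_of_ne _ _ hlp (by rwa [hp])]
            exact fun h => hlp (slot_inj h (by rwa [hp]) (by rwa [hp]))
        have hF1 : faceWord (fun a b => a * b) p x =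
            Function.update z (slot p p) (z (slot p p) * TrivSqZeroExt.inl c) := by
          rw [hz' p hpi, hz, Function.update_idem, ← hx, ← hp,
            ← faceWord_self (fun a b => a * b) p x, Function.update_eq_self]
        have hF2 : Function.update z (finRotate _ (slot p p))
            (TrivSqZeroExt.inl c * z (finRotate _ (slot p p))) =
            faceWord (fun a b => a * b) i x := by
          rw [eq_faceWord_iff]
          constructor
          · rw [← e, Function.update_self, ha, hz' _ (rot_ne i), hx]
          · intro l h1 h2
            have hs : slot i l = slot p l := ((s1 l h1).resolve_right h2).symm
            rw [Function.update_of_ne, hs, hz' l h1]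
            rw [e]
            exact fun h => h1 (slot_inj h h2 (rot_ne i).symm)
        rw [← hF2, hF1]
        exact cls_balance z (slot p p) hc
      · intro j _ hj
        simp only [Finset.mem_insert, Finset.mem_singleton, not_or] at hj
        refine smul_eq_zero_of_right _ ?_
        have h2 : i ≠ finRotate _ j := by
          rw [← hp]; exact fun h => hj.1 ((finRotate _).injective h).symm
        exact cls_degenerate _ (slot j i) hc (slot_ne_zero hi (Ne.symm hj.2) h2)
          (by rw [faceWord_of_ne _ _ (Ne.symm hj.2) h2, hx]))

theorem hoch_cls {L : ℕ} (x : Fin (L + 2) → TrivSqZeroExt A M) :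
    hoch (cls K x) = ∑ j : Fin (L + 2), (-1 : k) ^ (j : ℕ) •
      cls K (faceWord (fun a b => a * b) j x) := by
  rw [hoch, cls, Submodule.mkQ_apply, Submodule.liftQ_apply]
  simp only [LinearMap.comp_apply, LinearMap.sum_apply, LinearMap.smul_apply, map_sum,
    map_smul, face_tprod]
  rfl

/-- The summand of `t` for words whose last letter in `M` is at position `i`: it projects letter
`i` to `M` and all later letters to `A`, and then rotates. Precomposing a word with the `i`-th power
of `finRotate L` gives `x_i ⋯ x_{L-1} x₀ ⋯ x_{i-1}`. -/
def rotPart {L : ℕ} (i : Fin L) : Ten k A M L →ₗ[k] Ten k A M L :=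
  (-1 : k) ^ ((i : ℕ) * (L - 1)) •
    ((PiTensorProduct.reindex k (fun _ : Fin L => TrivSqZeroExt A M)
        (finRotate L ^ (i : ℕ)).symm).toLinearMap.comp
      (PiTensorProduct.map fun l => if l < i then LinearMap.id
        else if l = i then projM k A M else projA k A M))

theorem rotPart_tprod {L : ℕ} (i : Fin L) (x : Fin L → TrivSqZeroExt A M) :
    rotPart i (PiTensorProduct.tprod k x) = (-1 : k) ^ ((i : ℕ) * (L - 1)) •
      PiTensorProduct.tprod k ((fun l => (if l < i then LinearMap.id
        else if l = i then projM k A M else projA k A M) (x l)) ∘ ⇑(finRotate L ^ (i : ℕ))) := by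
  rw [rotPart, LinearMap.smul_apply, LinearMap.comp_apply, PiTensorProduct.map_tprod]
  congr 1
  exact PiTensorProduct.reindex_tprod _ _

theorem cls_rot_balance {L : ℕ} (n : ℕ) (x : Fin L → TrivSqZeroExt A M) (i : Fin L) {c : A}
    (hc : c ∈ K) :
    cls K (Function.update x i (x i * TrivSqZeroExt.inl c) ∘ ⇑(finRotate L ^ n)) =
      cls K (Function.update x (finRotate L i) (TrivSqZeroExt.inl c * x (finRotate L i)) ∘
        ⇑(finRotate L ^ n)) := by
  obtain ⟨i, rfl⟩ := (finRotate L ^ n).surjective i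
  have hcm : finRotate L ((finRotate L ^ n) i) = (finRotate L ^ n) (finRotate L i) := by
    rw [← Equiv.Perm.mul_apply, ← Equiv.Perm.mul_apply, ← pow_succ, ← pow_succ']
  rw [hcm, Function.update_comp_eq_of_injective _ (finRotate L ^ n).injective,
    Function.update_comp_eq_of_injective _ (finRotate L ^ n).injective]
  exact cls_balance (x ∘ ⇑(finRotate L ^ n)) i hc

/-- The operator `t`: on a word `x₀ ⊗ ⋯ ⊗ x_n` with letters in `A ∪ M` and with `x_i` its last
letter in `M`, it is `(-1)^(i n) x_i ⊗ ⋯ ⊗ x_n ⊗ x₀ ⊗ ⋯ ⊗ x_{i-1}`; see `cyc_cls`. -/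
def cyc {L : ℕ} : Cyc M K L →ₗ[k] Cyc M K L :=
  Submodule.liftQ _ ((Submodule.mkQ _).comp (∑ i : Fin L, rotPart i)) (by
    apply le_comap
    · intro x l c hc
      simp only [LinearMap.comp_apply, LinearMap.sum_apply, map_sum, map_smul, rotPart_tprod]
      refine Finset.sum_congr rfl fun i _ => ?_
      congr 1
      set g : Fin L → TrivSqZeroExt A M →ₗ[k] TrivSqZeroExt A M := fun l =>
        if l < i then LinearMap.id else if l = i then projM k A M else projA k A M with hg
      have hl : ∀ l a, g l (TrivSqZeroExt.inl c * a) = TrivSqZeroExt.inl c * g l a := by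
        intro l a
        simp only [hg]
        split_ifs <;> ext <;> simp [projA, projM]
      have hr : ∀ l a, g l (a * TrivSqZeroExt.inl c) = g l a * TrivSqZeroExt.inl c := by
        intro l a
        simp only [hg]
        split_ifs <;> ext <;> simp [projA, projM]
      have hu : ∀ l a, (fun m => g m (Function.update x l a m)) =
          Function.update (fun m => g m (x m)) l (g l a) := by
        intro l a
        funext m
        by_cases h : m = l
        · subst h; simp
        · simp [Function.update_of_ne h]
      have := cls_rot_balance (K := K) (i : ℕ) (fun m => g m (x m)) l hc
      rw [← hl, ← hr, ← hu, ← hu] at this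
      exact this
    · intro x l c hc hl0 hx
      simp only [LinearMap.comp_apply, LinearMap.sum_apply, map_sum, map_smul, rotPart_tprod]
      refine Finset.sum_eq_zero fun i _ => smul_eq_zero_of_right _ ?_
      obtain ⟨m, hm⟩ := (finRotate L ^ (i : ℕ)).surjective l
      by_cases hli : l = i
      · subst hli
        exact cls_eq_zero _ m (by simp [hm, hx, projM])
      · refine cls_degenerate _ m hc ?_ (c := c) ?_
        · intro h0
          apply hli
          rw [Fin.ext_iff, ← hm, rot_pow_val, h0, zero_add, Nat.mod_eq_of_lt i.isLt]
        · simp only [Function.comp_apply, hm, hx]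
          split_ifs
          · rfl
          · ext <;> simp [projA])

theorem cyc_cls_eq_sum {L : ℕ} (x : Fin L → TrivSqZeroExt A M) :
    cyc (cls K x) = ∑ i : Fin L, (-1 : k) ^ ((i : ℕ) * (L - 1)) •
      cls K ((fun l => (if l < i then LinearMap.id
        else if l = i then projM k A M else projA k A M) (x l)) ∘ ⇑(finRotate L ^ (i : ℕ))) := by
  rw [cyc, cls, Submodule.mkQ_apply, Submodule.liftQ_apply]
  simp only [LinearMap.comp_apply, LinearMap.sum_apply, map_sum, map_smul, rotPart_tprod]
  rfl

/-- If the last letter of the word lying in `M` is at position `i`, then `t` rotates the word by `i`. -/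
theorem cyc_cls {L : ℕ} (x : Fin L → TrivSqZeroExt A M) (i : Fin L) (hi : (x i).fst = 0)
    (hlast : ∀ l, i < l → (x l).snd = 0) :
    cyc (cls K x) = (-1 : k) ^ ((i : ℕ) * (L - 1)) • cls K (x ∘ ⇑(finRotate L ^ (i : ℕ))) := by
  rw [cyc_cls_eq_sum, Finset.sum_eq_single i]
  · congr 3
    funext l
    split_ifs with h1 h2
    · rfl
    · subst h2; ext <;> simp [projM, hi]
    · ext <;> simp [projA, hlast l (lt_of_le_of_ne (not_lt.1 h1) (Ne.symm h2))]
  · intro i' _ hne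
    refine smul_eq_zero_of_right _ ?_
    rcases lt_or_gt_of_ne hne with h | h
    · obtain ⟨m, hm⟩ := (finRotate L ^ (i' : ℕ)).surjective i
      refine cls_eq_zero _ m ?_
      simp only [Function.comp_apply, hm, if_neg (not_lt.2 h.le), if_neg h.ne']
      ext <;> simp [projA, hi]
    · obtain ⟨m, hm⟩ := (finRotate L ^ (i' : ℕ)).surjective i'
      refine cls_eq_zero _ m ?_
      simp only [Function.comp_apply, hm, lt_irrefl, if_false, if_true]
      ext <;> simp [projM, hlast i' h]
  · simp

end Tensors

section MWords

variable {k A M : Type*} [CommRing k] [Ring A] [Algebra k A] [AddCommGroup M] [Module k M]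
  [Module A M] [Module Aᵐᵒᵖ M] [SMulCommClass A Aᵐᵒᵖ M] [IsScalarTower k A M]
  [IsScalarTower k Aᵐᵒᵖ M] {K : Subalgebra k A}

/-- The letters of `x` at the positions in `s` belong to `M`, the other ones to `A`. -/
structure IsMWord {L : ℕ} (s : Finset (Fin L)) (x : Fin L → TrivSqZeroExt A M) : Prop where
  fst_eq : ∀ l ∈ s, (x l).fst = 0
  snd_eq : ∀ l ∉ s, (x l).snd = 0

variable (M K) in
/-- The span of the words of length `L` whose letters are in `A ∪ M`, with exactly `m` of them, among
these the letter `x₀`, in `M`. -/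
def wordSpan (L m : ℕ) : Submodule k (Cyc M K L) :=
  Submodule.span k {z | ∃ (s : Finset (Fin L)) (x : Fin L → TrivSqZeroExt A M),
    s.card = m ∧ (∃ i ∈ s, i.val = 0) ∧ IsMWord s x ∧ z = cls K x}

theorem wordSpan_zero (L : ℕ) : wordSpan M K L 0 = ⊥ := by
  rw [eq_bot_iff, wordSpan, Submodule.span_le]
  rintro _ ⟨s, x, hs, ⟨i, hi, -⟩, -⟩
  rw [Finset.card_eq_zero] at hs
  simp [hs] at hi

theorem exists_last {L : ℕ} {s : Finset (Fin L)} (h : s.Nonempty) :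
    ∃ i ∈ s, ∀ l, i < l → l ∉ s :=
  ⟨s.max' h, s.max'_mem h, fun l hl hls => absurd (s.le_max' l hls) (not_le.2 hl)⟩

theorem cyc_mem {L m : ℕ} {z : Cyc M K L} (hz : z ∈ wordSpan M K L m) :
    cyc z ∈ wordSpan M K L m := by
  revert z
  change wordSpan M K L m ≤ (wordSpan M K L m).comap cyc
  rw [wordSpan, Submodule.span_le]
  rintro _ ⟨s, x, hs, ⟨i0, hi0, h0⟩, hx, rfl⟩
  obtain ⟨i, hi, hl⟩ := exists_last ⟨i0, hi0⟩
  rw [SetLike.mem_coe, Submodule.mem_comap,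
    cyc_cls x i (hx.fst_eq i hi) fun l h => hx.snd_eq l (hl l h)]
  refine Submodule.smul_mem _ _ (Submodule.subset_span
    ⟨s.map (finRotate L ^ (i : ℕ)).symm.toEmbedding, _, by simpa using hs, ⟨i0, ?_, h0⟩, ?_, rfl⟩)
  · rw [Finset.mem_map_equiv, Equiv.symm_symm]
    convert hi
    rw [Fin.ext_iff, rot_pow_val, h0, zero_add, Nat.mod_eq_of_lt i.isLt]
  · constructor
    · intro l hl
      rw [Finset.mem_map_equiv, Equiv.symm_symm] at hl
      exact hx.fst_eq _ hl
    · intro l hl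
      rw [Finset.mem_map_equiv, Equiv.symm_symm] at hl
      exact hx.snd_eq _ hl

theorem slot_zero {L : ℕ} {j i0 : Fin (L + 2)} (h0 : i0.val = 0) : (slot j i0).val = 0 := by
  rw [slot_val]; split_ifs <;> omega

theorem isMWord_face {L : ℕ} {f : TrivSqZeroExt A M → TrivSqZeroExt A M → TrivSqZeroExt A M}
    {j : Fin (L + 2)} {s : Finset (Fin (L + 2))} {x : Fin (L + 2) → TrivSqZeroExt A M}
    (hx : IsMWord s x)
    (h1 : (j ∈ s ∨ finRotate _ j ∈ s) → (f (x j) (x (finRotate _ j))).fst = 0)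
    (h2 : j ∉ s → finRotate _ j ∉ s → (f (x j) (x (finRotate _ j))).snd = 0) :
    IsMWord (s.image (slot j)) (faceWord f j x) := by
  constructor
  · intro p hp
    obtain ⟨l, hl, rfl⟩ := Finset.mem_image.1 hp
    by_cases e1 : l = j
    · subst e1; rw [faceWord_self]; exact h1 (Or.inl hl)
    by_cases e2 : l = finRotate _ j
    · subst e2; rw [slot_rot_self, faceWord_self]; exact h1 (Or.inr hl)
    · rw [faceWord_of_ne _ _ e1 e2]; exact hx.fst_eq _ hl
  · intro p hp
    obtain ⟨l, rfl⟩ := slot_surj j p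
    have hl : l ∉ s := fun h => hp (Finset.mem_image_of_mem _ h)
    by_cases e : l = j ∨ l = finRotate _ j
    · have e' : slot j l = slot j j := by
        rcases e with rfl | rfl
        · rfl
        · exact slot_rot_self j
      rw [e'] at hp ⊢
      rw [faceWord_self]
      refine h2 (fun h => hp (Finset.mem_image_of_mem _ h)) fun h => hp ?_
      rw [← slot_rot_self]
      exact Finset.mem_image_of_mem _ h
    · rw [not_or] at e
      rw [faceWord_of_ne _ _ e.1 e.2]; exact hx.snd_eq _ hl

theorem hoch_mem {L m : ℕ} {z : Cyc M K (L + 1)} (hz : z ∈ wordSpan M K (L + 1) m) :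
    hoch z ∈ wordSpan M K L m := by
  obtain _ | L := L
  · have : (hoch : Cyc M K (0 + 1) →ₗ[k] Cyc M K 0) = 0 := by
      apply cyc_ext
      intro x
      rw [hoch, cls, Submodule.mkQ_apply, Submodule.liftQ_apply]
      simp [face]
    rw [this]; exact Submodule.zero_mem _
  revert z
  change wordSpan M K (L + 2) m ≤ (wordSpan M K (L + 1) m).comap hoch
  rw [wordSpan, Submodule.span_le]
  rintro _ ⟨s, x, hs, ⟨i0, hi0, h0⟩, hx, rfl⟩
  rw [SetLike.mem_coe, Submodule.mem_comap, hoch_cls]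
  refine Submodule.sum_mem _ fun j _ => Submodule.smul_mem _ _ ?_
  by_cases hb : j ∈ s ∧ finRotate _ j ∈ s
  · rw [cls_eq_zero _ (slot j j)]
    · exact Submodule.zero_mem _
    · rw [faceWord_self]
      ext <;> simp [-finRotate_apply, hx.fst_eq _ hb.1, hx.fst_eq _ hb.2]
  · refine Submodule.subset_span ⟨s.image (slot j), _, ?_,
      ⟨slot j i0, Finset.mem_image_of_mem _ hi0, slot_zero h0⟩, isMWord_face hx ?_ ?_, rfl⟩
    · rw [Finset.card_image_of_injOn, hs]
      intro l hl l' hl' h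
      by_cases e : finRotate _ j ∈ s
      · have hj : j ∉ s := fun h => hb ⟨h, e⟩
        by_contra hne
        by_cases e1 : l = finRotate _ j
        · subst e1
          rw [slot_rot_self] at h
          exact hj (slot_inj h (rot_ne j).symm (Ne.symm hne) ▸ hl')
        by_cases e2 : l' = finRotate _ j
        · subst e2
          rw [slot_rot_self] at h
          exact hj (slot_inj h e1 (rot_ne j).symm ▸ hl)
        · exact hne (slot_inj h e1 e2)
      · exact slot_inj h (fun h => e (h ▸ hl)) (fun h => e (h ▸ hl'))
    · rintro (h | h) <;> simp [-finRotate_apply, hx.fst_eq _ h]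
    · intro h h'; simp [-finRotate_apply, hx.snd_eq _ h, hx.snd_eq _ h']

theorem rho_mem (D : BimoduleMul k A M) {L m : ℕ} (j : Fin (L + 1)) {z : Cyc M K (L + 1)}
    (hz : z ∈ wordSpan M K (L + 1) (m + 1)) : rho D j z ∈ wordSpan M K L m := by
  obtain _ | L := L
  · have : (rho D j : Cyc M K (0 + 1) →ₗ[k] Cyc M K 0) = 0 := by
      apply cyc_ext
      intro x
      rw [rho, cls, Submodule.mkQ_apply, Submodule.liftQ_apply]
      simp [face]
    rw [this]; exact Submodule.zero_mem _
  revert z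
  change wordSpan M K (L + 2) (m + 1) ≤ (wordSpan M K (L + 1) m).comap (rho D j)
  rw [wordSpan, Submodule.span_le]
  rintro _ ⟨s, x, hs, ⟨i0, hi0, h0⟩, hx, rfl⟩
  rw [SetLike.mem_coe, Submodule.mem_comap, rho_cls]
  refine Submodule.smul_mem _ _ ?_
  by_cases hb : j ∈ s ∧ finRotate _ j ∈ s
  · refine Submodule.subset_span ⟨s.image (slot j), _, ?_,
      ⟨slot j i0, Finset.mem_image_of_mem _ hi0, slot_zero h0⟩, isMWord_face hx ?_ ?_, rfl⟩
    · have hi : s.image (slot j) = (s.erase (finRotate _ j)).image (slot j) := by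
        apply le_antisymm
        · intro p hp
          obtain ⟨l, hl, rfl⟩ := Finset.mem_image.1 hp
          by_cases e : l = finRotate _ j
          · subst e
            rw [slot_rot_self]
            exact Finset.mem_image_of_mem _ (Finset.mem_erase.2 ⟨(rot_ne j).symm, hb.1⟩)
          · exact Finset.mem_image_of_mem _ (Finset.mem_erase.2 ⟨e, hl⟩)
        · exact Finset.image_subset_image (Finset.erase_subset _ _)
      rw [hi, Finset.card_image_of_injOn, Finset.card_erase_of_mem hb.2, hs, Nat.add_sub_cancel]
      intro l hl l' hl' h
      exact slot_inj h (Finset.ne_of_mem_erase hl) (Finset.ne_of_mem_erase hl')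
    · intro _; simp
    · intro h; exact absurd hb.1 h
  · rw [cls_eq_zero _ (slot j j)]
    · exact Submodule.zero_mem _
    · rw [faceWord_self, nabla_apply]
      rw [not_and_or] at hb
      rcases hb with h | h <;> simp [-finRotate_apply, hx.snd_eq _ h]

theorem neg_one_pow_two_mul_add (a b n : ℕ) (h : a = b + 2 * n) : (-1 : k) ^ a = (-1) ^ b := by
  rw [h, pow_add, pow_mul]; simp

/-- The last letter in `M` after merging to its left. -/
theorem cyc_face_lt {L : ℕ} {f : TrivSqZeroExt A M → TrivSqZeroExt A M → TrivSqZeroExt A M}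
    (hf : ∀ a b, b.fst = 0 → (f a b).fst = 0) (x : Fin (L + 2) → TrivSqZeroExt A M)
    (i j : Fin (L + 2)) (hi : (x i).fst = 0) (hlast : ∀ l, i < l → (x l).snd = 0) (hj : j < i) :
    cyc (cls K (faceWord f j x)) = (-1 : k) ^ (((i : ℕ) - 1) * L) •
      cls K (faceWord f j x ∘ ⇑(finRotate (L + 1) ^ ((i : ℕ) - 1))) := by
  rw [Fin.lt_def] at hj
  have hil := i.isLt
  have hp : (slot j i).val = (i : ℕ) - 1 := by rw [slot_val]; split_ifs <;> omega
  rw [cyc_cls _ (slot j i), hp, Nat.add_sub_cancel]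
  · by_cases e : i = finRotate _ j
    · rw [e, slot_rot_self, faceWord_self]
      exact hf _ _ (e ▸ hi)
    · rw [faceWord_of_ne _ _ (by rintro rfl; omega) e]; exact hi
  · intro p hp'
    obtain ⟨l, rfl⟩ := slot_surj j p
    rw [Fin.lt_def, slot_val, slot_val] at hp'
    have hr := rot_val j
    have h1 : i < l := by rw [Fin.lt_def]; split_ifs at hp' <;> omega
    rw [faceWord_of_ne]
    · exact hlast l h1
    · rintro rfl; rw [Fin.lt_def] at h1; omega
    · rintro rfl
      rw [Fin.lt_def] at h1
      rw [hr] at h1 hp'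
      split_ifs at * <;> omega

/-- The last letter in `M` after merging `A`-letters to its right, or the letter itself. -/
theorem cyc_face_ge {L : ℕ} (x : Fin (L + 2) → TrivSqZeroExt A M)
    (i j : Fin (L + 2)) (hi : (x i).fst = 0) (hlast : ∀ l, i < l → (x l).snd = 0) (hj : i ≤ j)
    (hiL : i.val ≠ L + 1) :
    cyc (cls K (faceWord (fun a b => a * b) j x)) = (-1 : k) ^ ((i : ℕ) * L) •
      cls K (faceWord (fun a b => a * b) j x ∘ ⇑(finRotate (L + 1) ^ (i : ℕ))) := by
  rw [Fin.le_def] at hj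
  have hjl := j.isLt
  have hp : (slot j i).val = (i : ℕ) := by rw [slot_val]; split_ifs <;> omega
  rw [cyc_cls _ (slot j i), hp, Nat.add_sub_cancel]
  · by_cases e : i = j
    · subst e; rw [faceWord_self]; simp [hi]
    by_cases e' : i = finRotate _ j
    · rw [e', slot_rot_self, faceWord_self]; simp [← e', hi]
    · rw [faceWord_of_ne _ _ e e']; exact hi
  · intro p hp'
    obtain ⟨l, rfl⟩ := slot_surj j p
    rw [Fin.lt_def, hp] at hp'
    have hr := rot_val j
    by_cases e : l = j ∨ l = finRotate _ j
    · have e' : slot j l = slot j j := by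
        rcases e with rfl | rfl
        · rfl
        · exact slot_rot_self j
      rw [e', slot_val] at hp'
      rw [e', faceWord_self]
      have h1 : i < j := by rw [Fin.lt_def]; split_ifs at hp' <;> omega
      have h2 : i < finRotate _ j := by
        rw [Fin.lt_def, hr]; split_ifs at hp' <;> split_ifs <;> omega
      simp [-finRotate_apply, hlast _ h1, hlast _ h2]
    · rw [not_or] at e
      rw [faceWord_of_ne _ _ e.1 e.2]
      refine hlast l ?_
      rw [slot_val] at hp'
      rw [Fin.lt_def]
      split_ifs at hp' <;> omega

theorem rot_pow_wrap {L : ℕ} {i j j0 : Fin (L + 2)}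
    (h : (finRotate (L + 2) ^ (i : ℕ)) j = j0) :
    (j0.val = j.val + i.val) ∨ (j0.val + (L + 2) = j.val + i.val ∧ j0 < i) := by
  have h1 := rot_pow_val' (i : ℕ) j i.isLt.le
  rw [h] at h1
  rw [Fin.lt_def]
  have := j.isLt
  split_ifs at h1 <;> omega

theorem hoch_cyc {L m : ℕ} {z : Cyc M K (L + 1)} (hz : z ∈ wordSpan M K (L + 1) m) :
    hoch (cyc z) = cyc (hoch z) := by
  obtain _ | L := L
  · have : (hoch : Cyc M K (0 + 1) →ₗ[k] Cyc M K 0) = 0 := by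
      apply cyc_ext
      intro x
      rw [hoch, cls, Submodule.mkQ_apply, Submodule.liftQ_apply]
      simp [face]
    rw [this]; simp
  induction hz using Submodule.span_induction with
  | zero => simp
  | add _ _ _ _ h1 h2 => simp only [map_add, h1, h2]
  | smul r _ _ h => simp only [map_smul, h]
  | mem z hz =>
    obtain ⟨s, x, hs, ⟨i0, hi0, h0⟩, hx, rfl⟩ := hz
    obtain ⟨i, hi, hl⟩ := exists_last ⟨i0, hi0⟩
    have hi' := hx.fst_eq i hi
    have hl' : ∀ l, i < l → (x l).snd = 0 := fun l h => hx.snd_eq l (hl l h)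
    rw [cyc_cls x i hi' hl', map_smul, hoch_cls, hoch_cls, map_sum, Finset.smul_sum,
      ← Equiv.sum_comp (finRotate (L + 2) ^ (i : ℕ))
        (fun j => cyc ((-1 : k) ^ (j : ℕ) • cls K (faceWord (fun a b => a * b) j x)))]
    refine Finset.sum_congr rfl fun j _ => ?_
    obtain ⟨j0, hj0⟩ : ∃ j0, (finRotate (L + 2) ^ (i : ℕ)) j = j0 := ⟨_, rfl⟩
    rw [hj0, map_smul, smul_smul, ← pow_add]
    have hjl := j.isLt
    have hil := i.isLt
    rcases rot_pow_wrap hj0 with h | ⟨h, hlt⟩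
    · by_cases hiL : i.val = L + 1
      · have hj0L : j0 = i := Fin.ext (by have := j0.isLt; omega)
        have hz : faceWord (fun a b => a * b) j0 x (slot j0 j0) = 0 := by
          rw [faceWord_self, hj0L]
          have : finRotate _ i = i0 := by
            rw [Fin.ext_iff, rot_val, h0, if_pos hiL]
          rw [this]
          ext <;> simp [hi', hx.fst_eq _ hi0]
        rw [faceWord_rot_of_le _ _ j j0 x h, cls_eq_zero (faceWord _ j0 x) (slot j0 j0) hz]
        obtain ⟨p, hp⟩ := (finRotate (L + 1) ^ (i : ℕ)).surjective (slot j0 j0)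
        rw [cls_eq_zero _ p (by rw [Function.comp_apply, hp, hz])]
        simp
      · rw [faceWord_rot_of_le _ _ j j0 x h,
          cyc_face_ge x i j0 hi' hl' (by rw [Fin.le_def]; omega) hiL, smul_smul, ← pow_add]
        congr 2
        rw [h, show L + 2 - 1 = L + 1 from rfl]
        ring
    · rw [faceWord_rot_of_lt _ _ j j0 x h hil.le,
        cyc_face_lt (fun a b h => by simp [h]) x i j0 hi' hl' hlt, smul_smul, ← pow_add]
      congr 1
      refine neg_one_pow_two_mul_add _ _ (L + 1) ?_
      rw [Fin.lt_def] at hlt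
      obtain ⟨i', hi'⟩ : ∃ i' : ℕ, i.val = i' + 1 := ⟨i.val - 1, by omega⟩
      rw [hi'] at h ⊢
      simp only [Nat.add_sub_cancel]
      have : j.val + i' + 1 = j0.val + (L + 2) := by omega
      nlinarith

variable (K) in
/-- `∑ ϱ_j` over `j < n`, for words of `n + 1` letters, where `n = L`. -/
def dPrimeL (D : BimoduleMul k A M) (L : ℕ) : Cyc M K (L + 1) →ₗ[k] Cyc M K L :=
  ∑ j : Fin L, rho D j.castSucc

variable (K) in
/-- `∑ ϱ_j` over `j ≤ n`, for words of `n + 1` letters, where `n = L`. -/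
def dL (D : BimoduleMul k A M) (L : ℕ) : Cyc M K (L + 1) →ₗ[k] Cyc M K L :=
  dPrimeL K D L + rho D (Fin.last L)

theorem dPrimeL_mem (D : BimoduleMul k A M) {L m : ℕ} {z : Cyc M K (L + 1)}
    (hz : z ∈ wordSpan M K (L + 1) (m + 1)) : dPrimeL K D L z ∈ wordSpan M K L m := by
  rw [dPrimeL, LinearMap.sum_apply]
  exact Submodule.sum_mem _ fun j _ => rho_mem D _ hz

theorem dL_mem (D : BimoduleMul k A M) {L m : ℕ} {z : Cyc M K (L + 1)}
    (hz : z ∈ wordSpan M K (L + 1) (m + 1)) : dL K D L z ∈ wordSpan M K L m :=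
  Submodule.add_mem _ (dPrimeL_mem D hz) (rho_mem D _ hz)

theorem dL_cyc (D : BimoduleMul k A M) {L m : ℕ} {z : Cyc M K (L + 1)}
    (hz : z ∈ wordSpan M K (L + 1) m) :
    dL K D L (cyc z) = rho D (Fin.last L) z + cyc (dPrimeL K D L z) := by
  obtain _ | L := L
  · have : ∀ j, (rho D j : Cyc M K (0 + 1) →ₗ[k] Cyc M K 0) = 0 := by
      intro j
      apply cyc_ext
      intro x
      rw [rho, cls, Submodule.mkQ_apply, Submodule.liftQ_apply]
      simp [face]
    simp [dL, dPrimeL, this]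
  induction hz using Submodule.span_induction with
  | zero => simp
  | add _ _ _ _ h1 h2 => simp only [map_add, h1, h2]; abel
  | smul r _ _ h => simp only [map_smul, h, smul_add]
  | mem z hz =>
    obtain ⟨s, x, hs, ⟨i0, hi0, h0⟩, hx, rfl⟩ := hz
    obtain ⟨i, hi, hl⟩ := exists_last ⟨i0, hi0⟩
    have hi' := hx.fst_eq i hi
    have hl' : ∀ l, i < l → (x l).snd = 0 := fun l h => hx.snd_eq l (hl l h)
    have hsum : ∀ y : Cyc M K (L + 2), dL K D (L + 1) y = ∑ j : Fin (L + 2), rho D j y := by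
      intro y
      rw [Fin.sum_univ_castSucc, dL, dPrimeL, LinearMap.add_apply, LinearMap.sum_apply]
    have hR : rho D (Fin.last (L + 1)) (cls K x) + cyc (dPrimeL K D (L + 1) (cls K x)) =
        ∑ j : Fin (L + 2), if j = Fin.last (L + 1) then rho D j (cls K x)
          else cyc (rho D j (cls K x)) := by
      rw [Fin.sum_univ_castSucc, if_pos rfl, dPrimeL, LinearMap.sum_apply, map_sum,
        add_comm (rho D (Fin.last (L + 1)) (cls K x))]
      congr 1
      exact Finset.sum_congr rfl fun j _ => by rw [if_neg (Fin.castSucc_lt_last j).ne]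
    rw [hR, hsum, ← Equiv.sum_comp (finRotate (L + 2) ^ (i : ℕ)) (fun j =>
      if j = Fin.last (L + 1) then rho D j (cls K x) else cyc (rho D j (cls K x)))]
    refine Finset.sum_congr rfl fun j _ => ?_
    obtain ⟨j0, hj0⟩ : ∃ j0, (finRotate (L + 2) ^ (i : ℕ)) j = j0 := ⟨_, rfl⟩
    rw [hj0, cyc_cls x i hi' hl', map_smul, rho_cls, rho_cls, map_smul, smul_smul, ← pow_add]
    have hjl := j.isLt
    have hil := i.isLt
    have hj0l := j0.isLt
    rcases rot_pow_wrap hj0 with h | ⟨h, hlt⟩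
    · rw [faceWord_rot_of_le _ _ j j0 x h]
      by_cases hiL : i.val = L + 1
      · have hj : j0 = Fin.last (L + 1) := Fin.ext (by rw [Fin.val_last]; omega)
        have hid : (finRotate (L + 1) ^ (i : ℕ)) = 1 := by
          ext l
          rw [hiL, rot_pow_val]
          simp [Nat.mod_eq_of_lt l.isLt]
        rw [if_pos hj, hid, hj, Fin.val_last, hiL, show j.val = 0 by omega]
        congr 1
        refine neg_one_pow_two_mul_add _ _ ((L + 1) * L / 2) ?_
        have : 2 ∣ (L + 1) * L := by
          rw [mul_comm]; exact (Nat.even_mul_succ_self L).two_dvd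
        rw [Nat.mul_div_cancel' this]
        simp only [Nat.add_sub_cancel]
        ring
      · have hz : faceWord (fun a b => nabla D a b) j0 x (slot j0 j0) = 0 := by
          rw [faceWord_self, nabla_apply]
          by_cases hj : j0.val = L + 1
          · rw [hl' j0 (by rw [Fin.lt_def]; omega)]; simp
          · rw [hl' (finRotate _ j0) (by
              rw [Fin.lt_def, rot_val, if_neg hj]; omega)]; simp
        obtain ⟨p, hp⟩ := (finRotate (L + 1) ^ (i : ℕ)).surjective (slot j0 j0)
        rw [cls_eq_zero _ p (by rw [Function.comp_apply, hp, hz]), cls_eq_zero _ _ hz]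
        simp
    · have hj : j0 ≠ Fin.last (L + 1) := by
        rintro rfl
        rw [Fin.lt_def, Fin.val_last] at hlt; omega
      rw [if_neg hj, faceWord_rot_of_lt _ _ j j0 x h hil.le,
        cyc_face_lt (fun a b h => by simp) x i j0 hi' hl' hlt, smul_smul, ← pow_add]
      congr 1
      refine neg_one_pow_two_mul_add _ _ (L + 1) ?_
      rw [Fin.lt_def] at hlt
      obtain ⟨i', hi'⟩ : ∃ i' : ℕ, i.val = i' + 1 := ⟨i.val - 1, by omega⟩
      rw [hi'] at h ⊢
      simp only [Nat.add_sub_cancel]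
      have : j.val + i' + 1 = j0.val + (L + 2) := by omega
      nlinarith

theorem cyc_pow_cls {L : ℕ} {s : Finset (Fin L)} {x : Fin L → TrivSqZeroExt A M}
    (hx : IsMWord s x) (d a : ℕ) (had : a + d = L) :
    ∃ a', a ≤ a' ∧ a' ≤ L ∧ (∀ l : Fin L, a ≤ l.val → l.val < a' → l ∉ s) ∧
      ((cyc : Cyc M K L →ₗ[k] Cyc M K L) ^ (s.filter fun l => a ≤ l.val).card) (cls K x) =
        (-1 : k) ^ (a' * (L - 1)) • cls K (x ∘ ⇑(finRotate L ^ a')) := by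
  induction d generalizing a with
  | zero =>
    refine ⟨a, le_rfl, by omega, fun l h h' => by omega, ?_⟩
    have h1 : (s.filter fun l => a ≤ l.val) = ∅ := by
      rw [Finset.filter_eq_empty_iff]
      intro l _
      have := l.isLt
      omega
    have h2 : (finRotate L ^ a) = 1 := by
      ext l
      rw [rot_pow_val, show a = L by omega]
      simp [Nat.mod_eq_of_lt l.isLt]
    rw [h1, h2, Finset.card_empty, pow_zero, neg_one_pow_two_mul_add _ 0 (a * (L - 1) / 2)]
    · simp
    · have : 2 ∣ a * (L - 1) := by
        rw [show a = L by omega]; exact (Nat.even_mul_pred_self L).two_dvd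
      omega
  | succ d ih =>
    obtain ⟨a', h1, h2, h3, h4⟩ := ih (a + 1) (by omega)
    let l0 : Fin L := ⟨a, by omega⟩
    by_cases hl0 : l0 ∈ s
    · refine ⟨a, le_rfl, by omega, fun l h h' => by omega, ?_⟩
      have hc : (s.filter fun l => a ≤ l.val) =
          insert l0 (s.filter fun l => a + 1 ≤ l.val) := by
        ext l
        simp only [Finset.mem_filter, Finset.mem_insert, Fin.ext_iff]
        constructor
        · rintro ⟨h, h'⟩
          by_cases e : l.val = a
          · exact Or.inl e
          · exact Or.inr ⟨h, by omega⟩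
        · rintro (h | ⟨h, h'⟩)
          · exact ⟨(Fin.ext h : l = l0) ▸ hl0, h.ge⟩
          · exact ⟨h, by omega⟩
      rw [hc, Finset.card_insert_of_notMem (by simp [l0]), pow_succ', Module.End.mul_apply, h4,
        map_smul]
      let i : Fin L := ⟨a + L - a', by omega⟩
      have hi : (finRotate L ^ a') i = l0 := by
        rw [Fin.ext_iff, rot_pow_val]
        change (a + L - a' + a') % L = a
        rw [Nat.sub_add_cancel (by omega), Nat.add_mod_right, Nat.mod_eq_of_lt (by omega)]
      have hcomp : (x ∘ ⇑(finRotate L ^ a')) ∘ ⇑(finRotate L ^ (i : ℕ)) =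
          x ∘ ⇑(finRotate L ^ a) := by
        funext l
        simp only [Function.comp_apply]
        congr 1
        rw [Fin.ext_iff, rot_pow_val, rot_pow_val, rot_pow_val, Nat.mod_add_mod]
        change (l.val + (a + L - a') + a') % L = _
        rw [show l.val + (a + L - a') + a' = l.val + a + L by omega, Nat.add_mod_right]
      rw [cyc_cls _ i, hcomp, smul_smul, ← pow_add]
      · congr 1
        refine neg_one_pow_two_mul_add _ _ (L * (L - 1) / 2) ?_
        rw [Nat.mul_div_cancel' (Nat.even_mul_pred_self L).two_dvd, ← add_mul, ← add_mul]
        congr 1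
        change a' + (a + L - a') = _
        omega
      · rw [Function.comp_apply, hi]; exact hx.fst_eq _ hl0
      · intro l hl
        have hl' : a + L - a' < l.val := hl
        have := l.isLt
        have hv := rot_pow_val' a' l h2
        rw [if_neg (by omega)] at hv
        exact hx.snd_eq _ (h3 _ (by omega) (by omega))
    · refine ⟨a', by omega, h2, fun l h h' => ?_, ?_⟩
      · by_cases e : l.val = a
        · exact (Fin.ext e : l = l0) ▸ hl0
        · exact h3 l (by omega) h'
      · rw [← h4]
        congr 3
        ext l
        simp only [Finset.mem_filter, and_congr_right_iff]
        intro h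
        have : l.val ≠ a := fun e => hl0 ((Fin.ext e : l = l0) ▸ h)
        omega

theorem cyc_pow {L m : ℕ} {z : Cyc M K L} (hz : z ∈ wordSpan M K L m) :
    ((cyc : Cyc M K L →ₗ[k] Cyc M K L) ^ m) z = z := by
  induction hz using Submodule.span_induction with
  | zero => simp
  | add _ _ _ _ h1 h2 => simp only [map_add, h1, h2]
  | smul r _ _ h => simp only [map_smul, h]
  | mem z hz =>
    obtain ⟨s, x, hs, ⟨i0, hi0, h0⟩, hx, rfl⟩ := hz
    obtain ⟨a', -, -, h3, h4⟩ := cyc_pow_cls (K := K) hx L 0 (by omega)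
    have ha : a' = 0 := by
      by_contra h
      exact h3 i0 (by omega) (by omega) hi0
    rw [Finset.filter_true_of_mem (by simp), hs, ha] at h4
    rw [h4]
    simp

end MWords

section Complexes

variable {k A M : Type*} [CommRing k] [Ring A] [Algebra k A] [AddCommGroup M] [Module k M]
  [Module A M] [Module Aᵐᵒᵖ M] [SMulCommClass A Aᵐᵒᵖ M] [IsScalarTower k A M]
  [IsScalarTower k Aᵐᵒᵖ M]

section Basic

variable (M) (K : Subalgebra k A)

/-- The module `X_{v, m-1} = M ⊗ B^n_{m-1} ⊗`, where `n = v + m - 1`, realised in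
`E ⊗ Ē ⊗ ⋯ ⊗ Ē ⊗`: the span of the words of length `v + m` whose letters are in `A ∪ M`, with exactly
`m` of them, among these the first one, in `M`. The index `m` is the number of all letters in `M`,
the first one included, so `X v (w + 1)` is `X_{v,w}` and `X v 0 = 0` is `X_{v,-1}`. -/
def X (v m : ℕ) : Submodule k (Cyc M K (v + m)) := wordSpan M K (v + m) m

/-- `t` on `X_{v, m-1}`. -/
def tX (v m : ℕ) : Module.End k (X M K v m) := cyc.restrict fun _ => cyc_mem

/-- The Hochschild boundary, for a word length known to be `L' + 1` by an equation only. -/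
def hochOf {L L' : ℕ} (h : L = L' + 1) : Cyc M K L →ₗ[k] Cyc M K L' :=
  match L, h with
  | _, rfl => hoch

variable {M K} in
theorem hochOf_mem {L L' m : ℕ} (h : L = L' + 1) {z : Cyc M K L} (hz : z ∈ wordSpan M K L m) :
    hochOf M K h z ∈ wordSpan M K L' m := by
  subst h; exact hoch_mem hz

variable {M K} in
theorem hochOf_cyc {L L' m : ℕ} (h : L = L' + 1) {z : Cyc M K L} (hz : z ∈ wordSpan M K L m) :
    hochOf M K h (cyc z) = cyc (hochOf M K h z) := by
  subst h; exact hoch_cyc hz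

/-- `b = ∑ μⱼ : X_{v+1, m-1} → X_{v, m-1}`. -/
def bX (v m : ℕ) : X M K (v + 1) m →ₗ[k] X M K v m :=
  (hochOf M K (show v + 1 + m = v + m + 1 by omega)).restrict fun _ => hochOf_mem _

variable {M} in
/-- `d' = ∑ ϱ_j` over `j < n`, from `X_{v,m}` to `X_{v, m-1}`, where `n = v + m`. -/
def dPrimeX (D : BimoduleMul k A M) (v m : ℕ) : X M K v (m + 1) →ₗ[k] X M K v m :=
  (dPrimeL K D (v + m)).restrict fun _ => dPrimeL_mem D

variable {M} in
/-- `d = d' + ϱ_n`, from `X_{v,m}` to `X_{v, m-1}`, where `n = v + m`. -/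
def dX (D : BimoduleMul k A M) (v m : ℕ) : X M K v (m + 1) →ₗ[k] X M K v m :=
  (dL K D (v + m)).restrict fun _ => dL_mem D

/-- `N = 1 + t + ⋯ + t^(m-1)` on `X_{v, m-1}`. -/
def normX (v m : ℕ) : Module.End k (X M K v m) := ∑ l ∈ Finset.range m, tX M K v m ^ l

theorem tX_pow (v m : ℕ) : tX M K v m ^ m = 1 := by
  have h : ∀ (l : ℕ) (z : X M K v m), ((tX M K v m ^ l) z : Cyc M K (v + m)) =
      ((cyc : Cyc M K (v + m) →ₗ[k] Cyc M K (v + m)) ^ l) z := by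
    intro l z
    induction l with
    | zero => rfl
    | succ l ih => rw [pow_succ', pow_succ', Module.End.mul_apply, Module.End.mul_apply, ← ih]; rfl
  ext z
  rw [h, cyc_pow z.2]; rfl

theorem bX_tX (v m : ℕ) (z : X M K (v + 1) m) :
    bX M K v m (tX M K (v + 1) m z) = tX M K v m (bX M K v m z) :=
  Subtype.ext (hochOf_cyc _ z.2)

variable {M} in
theorem dX_sub (D : BimoduleMul k A M) (v m : ℕ) (z : X M K v (m + 1)) :
    dX K D v m (z - tX M K v (m + 1) z) =
      dPrimeX K D v m z - tX M K v m (dPrimeX K D v m z) := by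
  have h1 : (dX K D v m (tX M K v (m + 1) z) : Cyc M K (v + m)) =
      rho D (Fin.last (v + m)) z + cyc (dPrimeL K D (v + m) z) := dL_cyc D z.2
  have h2 : (dX K D v m z : Cyc M K (v + m)) = dPrimeL K D (v + m) z +
    rho D (Fin.last (v + m)) z := rfl
  apply Subtype.ext
  rw [map_sub, Submodule.coe_sub, h1, h2, Submodule.coe_sub]
  change _ = dPrimeL K D (v + m) z - cyc (dPrimeL K D (v + m) z)
  abel

/-- The image of `1 - t`. -/
def rangeOneSub (v m : ℕ) : Submodule k (X M K v m) := LinearMap.range (1 - tX M K v m)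

/-- `X̄_{v, m-1}`, the cokernel of `1 - t` on `X_{v, m-1}`. -/
abbrev XBar (v m : ℕ) : Type _ := X M K v m ⧸ rangeOneSub M K v m

instance (v m : ℕ) : AddCommGroup (XBar M K v m) := Submodule.Quotient.addCommGroup _

instance (v m : ℕ) : Module k (XBar M K v m) := Submodule.Quotient.module _

/-- `b̄`, the map induced by `b`. -/
def bBar (v m : ℕ) : XBar M K (v + 1) m →ₗ[k] XBar M K v m :=
  Submodule.mapQ _ _ (bX M K v m) (by
    rintro _ ⟨z, rfl⟩
    exact ⟨bX M K v m z, by simp [bX_tX]⟩)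

variable {M} in
/-- `d̄`, the map induced by `d`. -/
def dBar (D : BimoduleMul k A M) (v m : ℕ) : XBar M K v (m + 1) →ₗ[k] XBar M K v m :=
  Submodule.mapQ _ _ (dX K D v m) (by
    rintro _ ⟨z, rfl⟩
    exact ⟨dPrimeX K D v m z, (dX_sub K D v m z).symm⟩)

/-- `N̄ : X̄_{v, m-1} → X_{v, m-1}`, the map induced by `N`. -/
def normBar (v m : ℕ) : XBar M K v m →ₗ[k] X M K v m :=
  Submodule.liftQ _ (normX M K v m) (by
    rintro _ ⟨z, rfl⟩
    have h : normX M K v m * (1 - tX M K v m) = 1 - tX M K v m ^ m := by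
      exact geom_sum_mul_neg (R := Module.End k (X M K v m)) (tX M K v m) m
    rw [tX_pow] at h
    exact (LinearMap.congr_fun h z).trans (sub_self (z : X M K v m)))

end Basic

section Harmonic

variable (M) (K : Subalgebra k A)

/-- `Ẍ_{v,w} = X_{v,w} ⊕ X_{v,w-1}`. -/
abbrev DDotX (v w : ℕ) : Type _ := X M K v (w + 1) × X M K v w

/-- `b̈(x, y) = (b x, -b y)`. -/
def bDD (v w : ℕ) : DDotX M K (v + 1) w →ₗ[k] DDotX M K v w :=
  (bX M K v (w + 1)).prodMap (-bX M K v w)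

/-- `B̈(x, y) = (0, N x)`. -/
def BDD (v w : ℕ) : DDotX M K v w →ₗ[k] DDotX M K v (w + 1) :=
  LinearMap.prod 0 (normX M K v (w + 1) ∘ₗ LinearMap.fst k _ _)

variable {M} (D : BimoduleMul k A M)

/-- `d̈(x, y) = (d x + (1 - t) y, -d' y)`. -/
def dDD (v w : ℕ) : DDotX M K v (w + 1) →ₗ[k] DDotX M K v w :=
  LinearMap.prod
    (dX K D v (w + 1) ∘ₗ LinearMap.fst k _ _ + (1 - tX M K v (w + 1)) ∘ₗ LinearMap.snd k _ _)
    (-(dPrimeX K D v w ∘ₗ LinearMap.snd k _ _))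

/-- The Karoubi operator `κ̈(x, y) = (t x, t y) + (0, d' x - d x)`. -/
def karoubi (v w : ℕ) : Module.End k (DDotX M K v w) :=
  LinearMap.prod (tX M K v (w + 1) ∘ₗ LinearMap.fst k _ _)
    (tX M K v w ∘ₗ LinearMap.snd k _ _ + (dPrimeX K D v w - dX K D v w) ∘ₗ LinearMap.fst k _ _)

open Classical in
/-- The harmonic projection `P`: the identity on `ker (κ̈ - 1)²` and zero on `im (κ̈ - 1)²`. (It only
makes sense when `Ẍ_{v,w}` is the direct sum of both, which is a part of what is claimed; the value
`0` is a placeholder otherwise.) -/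
def harmonicProj (v w : ℕ) : Module.End k (DDotX M K v w) :=
  if h : IsCompl (LinearMap.ker ((karoubi K D v w - 1) ^ 2))
      (LinearMap.range ((karoubi K D v w - 1) ^ 2)) then
    Submodule.projection _ _ h else 0

/-- `P(Ẍ_{v,w})`. -/
def harmonicPart (v w : ℕ) : Submodule k (DDotX M K v w) := LinearMap.range (harmonicProj K D v w)

end Harmonic

section Tilde

variable [Algebra ℚ k] (M) (K : Subalgebra k A)

/-- `σ' = ∑ (w - j) / (w + 1) t^j`, over `0 ≤ j ≤ w - 1`, on `X_{v,w}`, where `w = m - 1`. -/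
def sigmaPrime (v m : ℕ) : X M K v m →ₗ[k] X M K v m :=
  ∑ j ∈ Finset.range (m - 1), algebraMap ℚ k (((m : ℚ) - 1 - j) / m) • tX M K v m ^ j

/-- `𝔭 : X_{v,w} → X̄_{v,w}`, `x ↦ [x] / (w + 1)`, where `w = m - 1`. -/
def pBar (v m : ℕ) : X M K v m →ₗ[k] XBar M K v m :=
  algebraMap ℚ k (1 / m) • Submodule.mkQ _

/-- `X̃_{v,w} = X̄_{v,w} ⊕ X̄_{v,w-1}`. -/
abbrev TildeX (v w : ℕ) : Type _ := XBar M K v (w + 1) × XBar M K v w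

/-- `b̃(x, y) = (b̄ x, -b̄ y)`. -/
def bTilde (v w : ℕ) : TildeX M K (v + 1) w →ₗ[k] TildeX M K v w :=
  (bBar M K v (w + 1)).prodMap (-bBar M K v w)

/-- `B̃(x, y) = (0, x)`. -/
def BTilde (v w : ℕ) : TildeX M K v w →ₗ[k] TildeX M K v (w + 1) :=
  LinearMap.prod 0 (LinearMap.fst k _ _)

variable {M} (D : BimoduleMul k A M)

/-- `d̃(x, y) = (d̄ x, -d̄ y)`. -/
def dTilde (v w : ℕ) : TildeX M K v (w + 1) →ₗ[k] TildeX M K v w :=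
  (dBar K D v (w + 1)).prodMap (-dBar K D v w)

/-- `ξ̄ = (w + 1)⁻¹ 𝔭 d' σ' d N̄ : X̄_{v,w} → X̄_{v,w-2}`, where `w = m + 1`. For `w = 1` the target
is zero. -/
def xiBar (v m : ℕ) : XBar M K v (m + 2) →ₗ[k] XBar M K v m :=
  algebraMap ℚ k (1 / (m + 2)) • (pBar M K v m ∘ₗ dPrimeX K D v m ∘ₗ
    sigmaPrime M K v (m + 1) ∘ₗ dX K D v (m + 1) ∘ₗ normBar M K v (m + 2))

/-- `ξ̃(x, y) = (0, ξ̄ x)`. -/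
def xiTilde (v w : ℕ) : TildeX M K v (w + 1) →ₗ[k] TildeX M K v w :=
  LinearMap.prod 0 (xiBar K D v w ∘ₗ LinearMap.fst k _ _)

/-- `Υ = (-1 + N̄ 𝔭) σ' d : X_{v,w} → X_{v,w-1}`, where `w = m`. It is used on `t`-invariant elements
only. For `w = 0` the target is zero. -/
def upsilon (v m : ℕ) : X M K v (m + 1) →ₗ[k] X M K v m :=
  (-1 + normBar M K v m ∘ₗ pBar M K v m) ∘ₗ sigmaPrime M K v m ∘ₗ dX K D v m

/-- `Ψ(x, y) = (w + 1)⁻¹ (N̄ x, Υ N̄ x) + (0, N̄ y)`. -/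
def Psi (v w : ℕ) : TildeX M K v w →ₗ[k] DDotX M K v w :=
  algebraMap ℚ k (1 / (w + 1)) •
      (LinearMap.prod (normBar M K v (w + 1)) (upsilon K D v w ∘ₗ normBar M K v (w + 1)) ∘ₗ
        LinearMap.fst k _ _) +
    LinearMap.prod 0 (normBar M K v w ∘ₗ LinearMap.snd k _ _)

end Tilde

end Complexes

section DoubleMixed

variable {k : Type*} [CommRing k] {X Y : ℕ → ℕ → Type*}
  [∀ v w, AddCommMonoid (X v w)] [∀ v w, Module k (X v w)]
  [∀ v w, AddCommMonoid (Y v w)] [∀ v w, Module k (Y v w)]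

/-- `(X, b, β, B)` is a double mixed complex: all of `b²`, `β²`, `B²`, `βb + bβ`, `βB + Bβ`, `bB + Bb`
vanish. The bigraded module `X` is concentrated in non-negative degrees, `b` lowers the first index,
`β` lowers the second one, and `B` raises it. The law `βB + Bβ = 0` reads `βB = 0` on the modules
`X v 0`, where `β` is zero. -/
structure IsDoubleMixedComplex (b : ∀ v w, X (v + 1) w →ₗ[k] X v w)
    (β : ∀ v w, X v (w + 1) →ₗ[k] X v w) (B : ∀ v w, X v w →ₗ[k] X v (w + 1)) : Prop where
  b_b : ∀ v w x, b v w (b (v + 1) w x) = 0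
  β_β : ∀ v w x, β v w (β v (w + 1) x) = 0
  B_B : ∀ v w x, B v (w + 1) (B v w x) = 0
  β_b : ∀ v w x, β v w (b v (w + 1) x) + b v w (β (v + 1) w x) = 0
  β_B : ∀ v w x, β v (w + 1) (B v (w + 1) x) + B v w (β v w x) = 0
  β_B_zero : ∀ v x, β v 0 (B v 0 x) = 0
  b_B : ∀ v w x, b v (w + 1) (B (v + 1) w x) + B v w (b v w x) = 0

/-- `f` is an isomorphism of double mixed complexes from `(X, b, β, B)` to `(Y, b', β', B')`. -/
structure IsDoubleMixedIso (b : ∀ v w, X (v + 1) w →ₗ[k] X v w)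
    (β : ∀ v w, X v (w + 1) →ₗ[k] X v w) (B : ∀ v w, X v w →ₗ[k] X v (w + 1))
    (b' : ∀ v w, Y (v + 1) w →ₗ[k] Y v w)
    (β' : ∀ v w, Y v (w + 1) →ₗ[k] Y v w) (B' : ∀ v w, Y v w →ₗ[k] Y v (w + 1))
    (f : ∀ v w, X v w →ₗ[k] Y v w) : Prop where
  bijective : ∀ v w, Function.Bijective (f v w)
  comm_b : ∀ v w x, b' v w (f (v + 1) w x) = f v w (b v w x)
  comm_β : ∀ v w x, β' v w (f v (w + 1) x) = f v w (β v w x)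
  comm_B : ∀ v w x, B' v w (f v w x) = f v (w + 1) (B v w x)

end DoubleMixed

end

end CleftExt

set_option linter.unusedSectionVars false

open scoped TensorProduct

/-! Over ℚ one can average over the finite cyclic action generated by `t`, and this turns the
theorem into linear algebra. On `X v m` one has t^m = 1. Write e = N/m for the projection onto the
invariants. The maps N̄ and 𝔭 identify X̄ with the invariants (`normBar_pBar`, `pBar_normBar`).
Under this identification b̄ becomes b, and d̄ becomes d′ because N d = d′ N (`normX_dX`). The
operator σ′ inverts 1 - t up to e: σ′(1 - t) = (1 - t)σ′ = 1 - e (`sigmaPrime_sub_tX`,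
`sub_tX_sigmaPrime`).

That Ẍ is a double mixed complex reduces to relations between b, d, d′, t and N. The sum b + d is
the alternating face sum of the associative product xy + x ▽ y, so its square vanishes and b, d
anticommute. The same works for b + d′ on words beginning in M. For N d = d′ N one first proves N d
= N ϱ_n N: the successive powers of t bring each letter of M in turn to the end of the word.

The Karoubi operator κ̈ is triangular with diagonal entries t, so it is a root of (X^w - 1)(X^(w+1)
- 1). For w > 0 this polynomial is (X - 1)² times a factor coprime to X - 1, whence the Fitting
decomposition (`isCompl_karoubi`). A pair (u, y) lies in ker (κ̈ - 1)² exactly when u is invariant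
and (t - 1)y = d u - e d u. One solution is y = Υ u, and any two solutions differ by an invariant
element. So the harmonic part consists of the pairs (u, Υ u + y′) with u and y′ invariant, and these
are the values of the injective map Ψ (`Psi_mem`, `exists_Psi_eq`).

Finally d̈(u, Υ u) = (e d u, -d′Υ u), and -d′Υ u = Υ(e d u) + e d′σ′d u (`dPrimeX_upsilon`). The
last term is the correction ξ̄. Hence Ψ intertwines the operators, its image is stable, and the laws
of X̃ are pulled back from Ẍ along Ψ. -/

namespace CleftExt

noncomputable section

/-! ### Presimplicial identities for merging letters -/

section NatWords

variable {E : Type*}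

/-- The formula of `faceWord` for words indexed by natural numbers, with last letter `X n`. -/
def natFace (f : E → E → E) (n j : ℕ) (X : ℕ → E) (p : ℕ) : E :=
  if j = n then (if p = 0 then f (X n) (X 0) else X p)
  else if p < j then X p else if p = j then f (X p) (X (p + 1)) else X (p + 1)

/-- Indexing by natural numbers removes the casts between different `Fin` types, so that the face
identities become case distinctions within reach of `grind`. -/
theorem faceWord_eq_natFace (f : E → E → E) {L : ℕ} (j : Fin (L + 2)) (X : ℕ → E) :
    faceWord f j (fun i => X i.val) = fun p => natFace f (L + 1) j X p.val := by
  funext p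
  simp only [faceWord, natFace, Fin.ext_iff, Fin.val_last, Fin.val_zero, Fin.val_castSucc,
    Fin.val_succ]

theorem exists_nat_word {n : ℕ} (x : Fin (n + 1) → E) : ∃ X : ℕ → E, x = fun i => X i.val :=
  ⟨fun i => if h : i < n + 1 then x ⟨i, h⟩ else x 0, by
    funext i; simp; omega⟩

/-- Merging letters by `f`, except for the cyclic merging of the last letter with the first one,
which uses `g`. -/
def faceWord₂ (f g : E → E → E) {L : ℕ} (j : Fin (L + 2)) (x : Fin (L + 2) → E) :
    Fin (L + 1) → E :=
  faceWord (if j = Fin.last (L + 1) then g else f) j x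

/-- Merging at positions far apart commutes, and adjacent positions need associativity `hf`. Only j
= n involves `g`: for i = 0 both merges touch the first letter, which is `hfg`, and for i = n the
last two letters and the first are merged, which is `hgg`. Both are assumed at the first letter
alone, so that it may be required to lie in M. -/
theorem natFace_comm {f g : E → E → E} (hf : ∀ a b c, f (f a b) c = f a (f b c)) {X : ℕ → E}
    (hfg : ∀ a c, f (g a (X 0)) c = g a (f (X 0) c))
    (hgg : ∀ a b, g a (g b (X 0)) = g (f a b) (X 0)) {n i j p : ℕ} (hij : i ≤ j) (hj : j ≤ n)
    (hp : p < n) :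
    natFace (if i = n then g else f) n i
        (natFace (if j + 1 = n + 1 then g else f) (n + 1) (j + 1) X) p =
      natFace (if j = n then g else f) n j (natFace f (n + 1) i X) p := by
  rcases hj.lt_or_eq with hj | rfl
  · rw [if_neg (by omega), if_neg (by omega), if_neg (by omega)]
    unfold natFace
    rcases lt_trichotomy p i with h | h | h <;> rcases lt_trichotomy p j with h' | h' | h' <;>
      grind
  · unfold natFace
    grind

theorem faceWord₂_comm {f g : E → E → E} (hf : ∀ a b c, f (f a b) c = f a (f b c)) {L : ℕ}
    {x : Fin (L + 3) → E} (hfg : ∀ a c, f (g a (x 0)) c = g a (f (x 0) c))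
    (hgg : ∀ a b, g a (g b (x 0)) = g (f a b) (x 0)) {i j : Fin (L + 2)} (hij : i ≤ j) :
    faceWord₂ f g i (faceWord₂ f g j.succ x) = faceWord₂ f g j (faceWord₂ f g i.castSucc x) := by
  obtain ⟨X, rfl⟩ := exists_nat_word x
  have hi := i.isLt
  have hj := j.isLt
  funext p
  have := natFace_comm hf (X := X) hfg hgg (n := L + 1) (i := i) (j := j) (p := p) hij
    (by omega) p.isLt
  simp only [faceWord₂]
  rw [faceWord_eq_natFace, faceWord_eq_natFace, faceWord_eq_natFace, faceWord_eq_natFace]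
  simp only [Fin.ext_iff, Fin.val_last, Fin.val_succ, Fin.val_castSucc]
  -- `i.castSucc` is never the last position, so the inner face on the right uses `f`.
  rw [this, if_neg (show ¬ (i : ℕ) = L + 1 + 1 by omega)]

/-- The cancellation of the terms of a double sum behind `d² = 0` for presimplicial modules. -/
theorem sum_sum_neg_one_pow_eq_zero {k V : Type*} [CommRing k] [AddCommGroup V] [Module k V] {n : ℕ}
    (G : Fin (n + 2) → Fin (n + 1) → V)
    (hG : ∀ i j : Fin (n + 1), i ≤ j → G j.succ i = G i.castSucc j) :
    ∑ j : Fin (n + 2), ∑ i : Fin (n + 1), (-1 : k) ^ (j : ℕ) • (-1 : k) ^ (i : ℕ) • G j i = 0 := by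
  rw [← Fintype.sum_prod_type' (fun (j : Fin (n + 2)) (i : Fin (n + 1)) =>
      (-1 : k) ^ (j : ℕ) • (-1 : k) ^ (i : ℕ) • G j i),
    ← Finset.sum_filter_add_sum_filter_not Finset.univ
      (fun q : Fin (n + 2) × Fin (n + 1) => q.2.castSucc < q.1),
    ← eq_neg_iff_add_eq_zero, ← Finset.sum_neg_distrib]
  -- The bijection (j, i) ↦ (i, j - 1) from pairs with i < j to pairs with i ≥ j preserves the term
  -- and reverses its sign.
  refine Finset.sum_bij' (fun q hq => (q.2.castSucc, q.1.pred (by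
      rintro h; simp [h] at hq)))
    (fun q hq => (q.2.succ, q.1.castPred (by
      rintro h; simp [h, Fin.le_def] at hq; have := q.2.isLt; omega))) ?_ ?_ ?_ ?_ ?_
  · rintro ⟨j, i⟩ hq
    simp only [Finset.mem_filter, Finset.mem_univ, true_and, Fin.lt_def, Fin.val_castSucc,
      Fin.val_pred] at hq ⊢
    omega
  · rintro ⟨j, i⟩ hq
    simp only [Finset.mem_filter, Finset.mem_univ, true_and, Fin.lt_def, Fin.val_castSucc,
      Fin.val_succ, Fin.coe_castPred] at hq ⊢
    omega
  · rintro ⟨j, i⟩ hq; simp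
  · rintro ⟨j, i⟩ hq; simp
  · rintro ⟨j, i⟩ hq
    simp only [Finset.mem_filter, Finset.mem_univ, true_and] at hq
    obtain ⟨j, rfl⟩ := Fin.eq_succ_of_ne_zero (Fin.ne_zero_of_lt hq)
    simp only [Fin.pred_succ, Fin.val_castSucc, Fin.val_succ]
    rw [Fin.lt_def, Fin.val_castSucc, Fin.val_succ] at hq
    rw [hG i j (Fin.le_def.2 (by omega)), pow_succ, mul_neg_one, neg_smul,
      smul_comm ((-1 : k) ^ (i : ℕ))]

end NatWords

/-! ### Squares and anticommutators of b, d and d′ -/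

section Squares

variable {k A M : Type*} [CommRing k] [Ring A] [Algebra k A] [AddCommGroup M] [Module k M]
  [Module A M] [Module Aᵐᵒᵖ M] [SMulCommClass A Aᵐᵒᵖ M] [IsScalarTower k A M]
  [IsScalarTower k Aᵐᵒᵖ M] {K : Subalgebra k A}

/-- `T` is the alternating sum of the merging maps for `f`, with `g` used for the last one. -/
def IsFaceSum (f g : TrivSqZeroExt A M → TrivSqZeroExt A M → TrivSqZeroExt A M) {L : ℕ}
    (T : Cyc M K (L + 2) →ₗ[k] Cyc M K (L + 1)) : Prop :=
  ∀ x, T (cls K x) = ∑ j : Fin (L + 2), (-1 : k) ^ (j : ℕ) • cls K (faceWord₂ f g j x)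

theorem IsFaceSum.comp_cls {f g : TrivSqZeroExt A M → TrivSqZeroExt A M → TrivSqZeroExt A M} {L : ℕ}
    {T : Cyc M K (L + 2) →ₗ[k] Cyc M K (L + 1)} {T' : Cyc M K (L + 3) →ₗ[k] Cyc M K (L + 2)}
    (hT : IsFaceSum f g T) (hT' : IsFaceSum f g T') (hf : ∀ a b c, f (f a b) c = f a (f b c))
    {x : Fin (L + 3) → TrivSqZeroExt A M} (hfg : ∀ a c, f (g a (x 0)) c = g a (f (x 0) c))
    (hgg : ∀ a b, g a (g b (x 0)) = g (f a b) (x 0)) : T (T' (cls K x)) = 0 := by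
  rw [hT', map_sum]
  simp only [map_smul, hT _, Finset.smul_sum]
  exact sum_sum_neg_one_pow_eq_zero (fun j i => cls K (faceWord₂ f g i (faceWord₂ f g j x)))
    fun i j hij => by rw [faceWord₂_comm hf hfg hgg hij]

/-- The product enters in a single slot, so additivity is multilinearity of the tensor. It makes b +
d and b + d′ face sums of one product, to which `IsFaceSum.comp_cls` applies. -/
theorem cls_faceWord_add (f g : TrivSqZeroExt A M → TrivSqZeroExt A M → TrivSqZeroExt A M) {L : ℕ}
    (j : Fin (L + 2)) (x : Fin (L + 2) → TrivSqZeroExt A M) :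
    cls K (faceWord (fun a b => f a b + g a b) j x) =
      cls K (faceWord f j x) + cls K (faceWord g j x) := by
  have h : ∀ f', faceWord f' j x =
      Function.update (faceWord f j x) (slot j j) (f' (x j) (x (finRotate _ j))) := by
    intro f'
    symm
    rw [eq_faceWord_iff]
    refine ⟨Function.update_self _ _ _, fun l h1 h2 => ?_⟩
    rw [Function.update_of_ne fun h => h1 (slot_inj h h2 (rot_ne j).symm), faceWord_of_ne _ _ h1 h2]
  rw [h g, h (fun a b => f a b + g a b)]
  conv_rhs => enter [1]; rw [h f]
  simp only [cls, MultilinearMap.map_update_add, map_add]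

theorem cls_faceWord_zero {L : ℕ} (j : Fin (L + 2)) (x : Fin (L + 2) → TrivSqZeroExt A M) :
    cls K (faceWord (fun _ _ => 0) j x) = 0 :=
  cls_eq_zero _ (slot j j) (faceWord_self _ j x)

theorem isFaceSum_hoch {L : ℕ} : IsFaceSum (fun a b => a * b) (fun a b => a * b)
    (hoch : Cyc M K (L + 2) →ₗ[k] Cyc M K (L + 1)) := fun x => by
  simp only [hoch_cls, faceWord₂, ite_self]

theorem isFaceSum_dPrimeL (D : BimoduleMul k A M) {L : ℕ} :
    IsFaceSum (fun a b => nabla D a b) (fun _ _ => 0) (dPrimeL K D (L + 1)) := fun x => by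
  rw [Fin.sum_univ_castSucc, faceWord₂, if_pos rfl, cls_faceWord_zero, smul_zero, add_zero, dPrimeL,
    LinearMap.sum_apply]
  refine Finset.sum_congr rfl fun j _ => ?_
  rw [faceWord₂, if_neg (Fin.castSucc_lt_last j).ne, rho_cls]

theorem isFaceSum_dL (D : BimoduleMul k A M) {L : ℕ} :
    IsFaceSum (fun a b => nabla D a b) (fun a b => nabla D a b) (dL K D (L + 1)) := fun x => by
  rw [Fin.sum_univ_castSucc, dL, dPrimeL, LinearMap.add_apply, LinearMap.sum_apply]
  simp only [faceWord₂, ite_self, rho_cls]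

theorem IsFaceSum.add {f g f' g' : TrivSqZeroExt A M → TrivSqZeroExt A M → TrivSqZeroExt A M}
    {L : ℕ} {T T' : Cyc M K (L + 2) →ₗ[k] Cyc M K (L + 1)} (hT : IsFaceSum f g T)
    (hT' : IsFaceSum f' g' T') :
    IsFaceSum (fun a b => f a b + f' a b) (fun a b => g a b + g' a b) (T + T') := fun x => by
  rw [LinearMap.add_apply, hT, hT', ← Finset.sum_add_distrib]
  refine Finset.sum_congr rfl fun j _ => ?_
  simp only [faceWord₂]
  split_ifs <;> rw [cls_faceWord_add, smul_add]

theorem linearMap_eq_zero_of_mem_wordSpan {L m : ℕ} {V : Type*} [AddCommGroup V] [Module k V]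
    (T : Cyc M K (L + 1) →ₗ[k] V) (hT : ∀ x, (x 0).fst = 0 → T (cls K x) = 0) {z : Cyc M K (L + 1)}
    (hz : z ∈ wordSpan M K (L + 1) m) : T z = 0 := by
  revert z
  change wordSpan M K (L + 1) m ≤ LinearMap.ker T
  rw [wordSpan, Submodule.span_le]
  rintro _ ⟨s, x, -, ⟨i, hi, h0⟩, hx, rfl⟩
  exact hT x ((Fin.ext h0 : i = 0) ▸ hx.fst_eq i hi)

theorem hoch_zero_eq_zero : (hoch : Cyc M K (0 + 1) →ₗ[k] Cyc M K 0) = 0 := by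
  apply cyc_ext
  intro x
  rw [hoch, cls, Submodule.mkQ_apply, Submodule.liftQ_apply]
  simp [face]

theorem rho_zero_eq_zero (D : BimoduleMul k A M) (j : Fin 1) :
    (rho D j : Cyc M K (0 + 1) →ₗ[k] Cyc M K 0) = 0 := by
  apply cyc_ext
  intro x
  rw [rho, cls, Submodule.mkQ_apply, Submodule.liftQ_apply]
  simp [face]

theorem dPrimeL_zero_eq_zero (D : BimoduleMul k A M) : dPrimeL K D 0 = 0 := by
  simp [dPrimeL]

theorem dL_zero_eq_zero (D : BimoduleMul k A M) : dL K D 0 = 0 := by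
  simp [dL, dPrimeL_zero_eq_zero, rho_zero_eq_zero]

theorem hoch_hoch {L : ℕ} (z : Cyc M K (L + 2)) : hoch (hoch z) = (0 : Cyc M K L) := by
  obtain _ | L := L
  · rw [hoch_zero_eq_zero]; rfl
  refine LinearMap.congr_fun (f := hoch ∘ₗ hoch) (g := 0) (cyc_ext fun x => ?_) z
  exact isFaceSum_hoch.comp_cls isFaceSum_hoch (fun a b c => mul_assoc a b c)
    (fun a c => mul_assoc a _ c) (fun a b => (mul_assoc a b _).symm)

theorem nabla_assoc (D : BimoduleMul k A M) (a b c : TrivSqZeroExt A M) :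
    nabla D (nabla D a b) c = nabla D a (nabla D b c) := by
  simp [D.assoc]

theorem dPrimeL_dPrimeL (D : BimoduleMul k A M) {L : ℕ} (z : Cyc M K (L + 2)) :
    dPrimeL K D L (dPrimeL K D (L + 1) z) = 0 := by
  obtain _ | L := L
  · rw [dPrimeL_zero_eq_zero]; rfl
  refine LinearMap.congr_fun (f := dPrimeL K D (L + 1) ∘ₗ dPrimeL K D (L + 2)) (g := 0)
    (cyc_ext fun x => ?_) z
  exact (isFaceSum_dPrimeL D).comp_cls (isFaceSum_dPrimeL D) (nabla_assoc D)
    (fun a c => by simp) (fun a b => rfl)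

theorem dL_dL (D : BimoduleMul k A M) {L : ℕ} (z : Cyc M K (L + 2)) :
    dL K D L (dL K D (L + 1) z) = 0 := by
  obtain _ | L := L
  · rw [dL_zero_eq_zero]; rfl
  refine LinearMap.congr_fun (f := dL K D (L + 1) ∘ₗ dL K D (L + 2)) (g := 0)
    (cyc_ext fun x => ?_) z
  exact (isFaceSum_dL D).comp_cls (isFaceSum_dL D) (nabla_assoc D)
    (fun a c => nabla_assoc D a _ c) (fun a b => (nabla_assoc D a b _).symm)

/-- `xy + x ▽ y` is an associative product on `A ⊕ M`. -/
theorem mul_add_nabla_assoc (D : BimoduleMul k A M) (a b c : TrivSqZeroExt A M) :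
    (a * b + nabla D a b) * c + nabla D (a * b + nabla D a b) c =
      a * (b * c + nabla D b c) + nabla D a (b * c + nabla D b c) := by
  -- The terms with two equal products agree by associativity. The mixed terms agree only as a sum,
  -- by left and right linearity and balancedness of ▽.
  have h : nabla D a b * c + nabla D (a * b) c = a * nabla D b c + nabla D a (b * c) := by
    ext
    · simp
    · simp [D.smul_op, D.op_smul, D.balanced]
      abel
  simp only [add_mul, mul_add, map_add, LinearMap.add_apply, mul_assoc, nabla_assoc]
  rw [add_assoc, ← add_assoc _ _ (nabla D a _), h]
  abel

/-- Expand (b + d)² = 0, which holds by associativity of xy + x ▽ y, and cancel b² and d². -/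
theorem hoch_dL (D : BimoduleMul k A M) {L : ℕ} (z : Cyc M K (L + 2)) :
    hoch (dL K D (L + 1) z) + dL K D L (hoch z) = 0 := by
  obtain _ | L := L
  · rw [dL_zero_eq_zero, hoch_zero_eq_zero]; simp
  have h : ∀ x, ((hoch + dL K D (L + 1)) ∘ₗ (hoch + dL K D (L + 2))) (cls K x) =
      (0 : Cyc M K (L + 3) →ₗ[k] Cyc M K (L + 1)) (cls K x) := fun x =>
    (isFaceSum_hoch.add (isFaceSum_dL D)).comp_cls (isFaceSum_hoch.add (isFaceSum_dL D))
      (mul_add_nabla_assoc D) (fun a c => mul_add_nabla_assoc D a _ c)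
      (fun a b => (mul_add_nabla_assoc D a b _).symm)
  have := LinearMap.congr_fun (cyc_ext h) z
  simpa [hoch_hoch, dL_dL] using this

/-- Again (b + d′)² = 0, but now the cyclic face uses xy alone while the other faces use xy + x ▽ y.
These two products are compatible at a first letter from M, hence the restriction to `wordSpan`. -/
theorem hoch_dPrimeL (D : BimoduleMul k A M) {L m : ℕ} {z : Cyc M K (L + 2)}
    (hz : z ∈ wordSpan M K (L + 2) m) :
    hoch (dPrimeL K D (L + 1) z) + dPrimeL K D L (hoch z) = 0 := by
  obtain _ | L := L
  · rw [dPrimeL_zero_eq_zero, hoch_zero_eq_zero]; simp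
  have h : ((hoch + dPrimeL K D (L + 1)) ∘ₗ (hoch + dPrimeL K D (L + 2))) z = 0 := by
    refine linearMap_eq_zero_of_mem_wordSpan _ (fun x hx => ?_) hz
    refine (isFaceSum_hoch.add (isFaceSum_dPrimeL D)).comp_cls
      (isFaceSum_hoch.add (isFaceSum_dPrimeL D)) (mul_add_nabla_assoc D) (fun a c => ?_)
      (fun a b => ?_)
    -- On x₀ ∈ M the letter a acts through its A-component, with which both products in the letter c
    -- commute. In the second identity a ▽ b lies in M and therefore annihilates x₀.
    · ext <;> simp [hx, D.smul_op, smul_comm]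
    · ext <;> simp [hx, mul_smul]
  simpa [hoch_hoch, dPrimeL_dPrimeL] using h

end Squares

/-! ### The norm N and the identity N d = N ϱ_n N -/

section Norm

variable {k A M : Type*} [CommRing k] [Ring A] [Algebra k A] [AddCommGroup M] [Module k M]
  [Module A M] [Module Aᵐᵒᵖ M] [SMulCommClass A Aᵐᵒᵖ M] [IsScalarTower k A M]
  [IsScalarTower k Aᵐᵒᵖ M] {K : Subalgebra k A}

variable (M K) in
/-- The sum `1 + t + ⋯ + t^(m-1)`, on all words. -/
def normL (L m : ℕ) : Module.End k (Cyc M K L) := ∑ l ∈ Finset.range m, cyc ^ l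

/-- N(1 - t) = 1 - t^m, which kills the span of words with m letters in M, and this span is stable
under `t`. -/
theorem normL_cyc_pow {L m : ℕ} {z : Cyc M K L} (hz : z ∈ wordSpan M K L m) (c : ℕ) :
    normL M K L m ((cyc ^ c : Module.End k (Cyc M K L)) z) = normL M K L m z := by
  induction c with
  | zero => rfl
  | succ c ih =>
    have h : normL M K L m * (1 - cyc) = 1 - cyc ^ m :=
      geom_sum_mul_neg (R := Module.End k (Cyc M K L)) cyc m
    have hc : normL M K L m * cyc = normL M K L m - 1 + cyc ^ m := by
      rw [mul_sub, mul_one, sub_eq_iff_eq_add'] at h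
      nth_rw 2 [h]
      abel
    have hz' : ∀ c, (cyc ^ c : Module.End k (Cyc M K L)) z ∈ wordSpan M K L m := by
      intro c
      induction c with
      | zero => exact hz
      | succ c ih => rw [pow_succ']; exact cyc_mem ih
    have := LinearMap.congr_fun hc ((cyc ^ c : Module.End k (Cyc M K L)) z)
    simp only [Module.End.mul_apply, LinearMap.add_apply, LinearMap.sub_apply,
      Module.End.one_apply, cyc_pow (hz' c)] at this
    rw [pow_succ', Module.End.mul_apply, this, ← ih]
    abel

/-- The number of letters in `M` to the right of position `j`. -/
def countAfter {L : ℕ} (s : Finset (Fin L)) (j : Fin L) : ℕ :=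
  (s.filter fun l => j.val + 1 ≤ l.val).card

theorem countAfter_lt_of_lt {L : ℕ} {s : Finset (Fin L)} {i j : Fin L} (hj : j ∈ s) (h : i < j) :
    countAfter s j < countAfter s i := by
  refine Finset.card_lt_card (Finset.ssubset_iff.2 ⟨j, by simp, ?_⟩)
  intro l hl
  rw [Fin.lt_def] at h
  rcases Finset.mem_insert.1 hl with rfl | hl
  · exact Finset.mem_filter.2 ⟨hj, h⟩
  · rw [Finset.mem_filter] at hl ⊢
    exact ⟨hl.1, by omega⟩

theorem countAfter_injOn {L : ℕ} (s : Finset (Fin L)) : Set.InjOn (countAfter s) s := by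
  intro i hi j hj h
  rcases lt_trichotomy i j with h' | h' | h'
  · exact absurd h (countAfter_lt_of_lt hj h').ne'
  · exact h'
  · exact absurd h (countAfter_lt_of_lt hi h').ne

/-- Together with `countAfter_injOn` this matches the powers of `t` in N with the letters of the
word in M. -/
theorem image_countAfter {L : ℕ} (s : Finset (Fin L)) :
    s.image (countAfter s) = Finset.range s.card := by
  apply Finset.eq_of_subset_of_card_le
  · intro c hc
    obtain ⟨j, hj, rfl⟩ := Finset.mem_image.1 hc
    rw [Finset.mem_range]
    exact Finset.card_lt_card (Finset.ssubset_iff.2 ⟨j, by simp, fun l hl => by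
      rcases Finset.mem_insert.1 hl with rfl | hl
      · exact hj
      · exact (Finset.mem_filter.1 hl).1⟩)
  · rw [Finset.card_image_of_injOn (countAfter_injOn s), Finset.card_range]

theorem rho_cls_eq_zero_left (D : BimoduleMul k A M) {L : ℕ} {j : Fin (L + 2)}
    {x : Fin (L + 2) → TrivSqZeroExt A M} (h : (x j).snd = 0) : rho D j (cls K x) = 0 := by
  rw [rho_cls, cls_eq_zero _ (slot j j) (by rw [faceWord_self]; simp [h]), smul_zero]

theorem rho_cls_eq_zero_right (D : BimoduleMul k A M) {L : ℕ} {j : Fin (L + 2)}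
    {x : Fin (L + 2) → TrivSqZeroExt A M} (h : (x (finRotate _ j)).snd = 0) :
    rho D j (cls K x) = 0 := by
  rw [rho_cls, cls_eq_zero _ (slot j j) (by rw [faceWord_self, nabla_apply, h]; simp), smul_zero]

/-- Up to a power of `t`, merging at a letter in `M` is merging at the end of a rotated word. -/
theorem exists_rho_last_cyc_pow (D : BimoduleMul k A M) {L : ℕ} {s : Finset (Fin (L + 2))}
    {x : Fin (L + 2) → TrivSqZeroExt A M} (hx : IsMWord s x) {j : Fin (L + 2)} (hj : j ∈ s) :
    ∃ c : ℕ, rho D (Fin.last (L + 1))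
        ((cyc ^ countAfter s j : Module.End k (Cyc M K (L + 2))) (cls K x)) =
      (cyc ^ c : Module.End k (Cyc M K (L + 1))) (rho D j (cls K x)) := by
  have hjl := j.isLt
  obtain ⟨a, h1, h2, h3, h4⟩ := cyc_pow_cls (K := K) hx (L + 1 - j.val) (j.val + 1) (by omega)
  rw [countAfter, h4, map_smul]
  -- If a = j + 1, the power of `t` puts x_j at the end and its cyclic successor in front, so the
  -- last face is a rotation of ϱ_j. If a > j + 1, both the successor of x_j and the last letter of
  -- the rotated word lie in A, and both sides vanish.
  rcases h1.eq_or_lt with rfl | h1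
  · rw [rho_cls, faceWord_rot_of_lt _ (j.val + 1) (Fin.last (L + 1)) j x
      (by rw [Fin.val_last]; omega) h2, Nat.add_sub_cancel, Fin.val_last, smul_smul, ← pow_add]
    by_cases hr : finRotate _ j ∈ s
    · have hy : IsMWord (s.image (slot j)) (faceWord (fun a b => nabla D a b) j x) :=
        isMWord_face hx (fun _ => by simp) (fun h => absurd hj h)
      obtain ⟨a', g1, g2, g3, g4⟩ := cyc_pow_cls (K := K) hy (L + 1 - j.val) j.val (by omega)
      -- The rotation by j is an honest power of `t`, because the merged letter lies in M and stands
      -- in slot j. For j = L + 1 the bound on the length forces the equality.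
      have ha : a' = j.val := by
        by_contra h
        have hlt : j.val < L + 1 := by omega
        refine g3 ⟨j.val, hlt⟩ le_rfl (show j.val < a' by omega) ?_
        have : slot j j = ⟨j.val, hlt⟩ := by
          rw [Fin.ext_iff, slot_val, if_neg (by omega), if_pos le_rfl]
        rw [← this]
        exact Finset.mem_image_of_mem _ hj
      refine ⟨((s.image (slot j)).filter fun l => j.val ≤ l.val).card, ?_⟩
      rw [rho_cls, map_smul, g4, ha, smul_smul, ← pow_add]
      congr 1
      -- The exponents are (j + 1)(L + 1) + (L + 1) and j + jL.
      refine neg_one_pow_two_mul_add _ _ (L + 1) ?_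
      simp only [Nat.add_sub_cancel, show L + 2 - 1 = L + 1 from rfl]
      ring
    · have hz : faceWord (fun a b => nabla D a b) j x (slot j j) = 0 := by
        rw [faceWord_self, nabla_apply, hx.snd_eq _ hr]; simp
      obtain ⟨p, hp⟩ := (finRotate (L + 1) ^ (j : ℕ)).surjective (slot j j)
      refine ⟨0, ?_⟩
      rw [rho_cls, cls_eq_zero _ p (by rw [Function.comp_apply, hp, hz]), cls_eq_zero _ _ hz]
      simp
  · have hr : (finRotate _ j) ∉ s :=
      h3 _ (by rw [rot_val]; split_ifs <;> omega) (by rw [rot_val]; split_ifs <;> omega)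
    refine ⟨0, ?_⟩
    rw [rho_cls_eq_zero_right D (hx.snd_eq _ hr), rho_cls_eq_zero_left, smul_zero, map_zero]
    rw [Function.comp_apply]
    have hv := rot_pow_val' (L := L + 2) a (Fin.last (L + 1)) h2
    rw [Fin.val_last, if_neg (by omega)] at hv
    exact hx.snd_eq _ (h3 _ (by omega) (by omega))

/-- `N d = N ϱ_n N`, where `ϱ_n = d - d'`. -/
theorem normL_dL (D : BimoduleMul k A M) {L m : ℕ} {z : Cyc M K (L + 1)}
    (hz : z ∈ wordSpan M K (L + 1) (m + 1)) :
    normL M K L m (dL K D L z) =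
      normL M K L m (rho D (Fin.last L) (normL M K (L + 1) (m + 1) z)) := by
  obtain _ | L := L
  · rw [dL_zero_eq_zero, rho_zero_eq_zero]; simp
  induction hz using Submodule.span_induction with
  | zero => simp
  | add _ _ _ _ h1 h2 => simp only [map_add, h1, h2]
  | smul r _ _ h => simp only [map_smul, h]
  | mem z hz =>
    obtain ⟨s, x, hs, hi0, hx, rfl⟩ := hz
    have hmem : cls K x ∈ wordSpan M K (L + 2) (m + 1) :=
      Submodule.subset_span ⟨s, x, hs, hi0, hx, rfl⟩
    -- Faces at letters in A vanish, which leaves as many terms as there are powers of `t` in the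
    -- inner norm.
    have hd : dL K D (L + 1) (cls K x) = ∑ j ∈ s, rho D j (cls K x) := by
      rw [Finset.sum_subset (Finset.subset_univ s)
        fun j _ hj => rho_cls_eq_zero_left D (hx.snd_eq j hj), Fin.sum_univ_castSucc, dL, dPrimeL,
        LinearMap.add_apply, LinearMap.sum_apply]
    -- The inner norm is reindexed by the letters in M and compared with d term by term. The outer
    -- norm absorbs the remaining power of `t`.
    rw [hd, normL, normL, LinearMap.sum_apply (Finset.range (m + 1)), ← hs, ← image_countAfter,
      Finset.sum_image (countAfter_injOn s), map_sum, map_sum, map_sum]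
    refine Finset.sum_congr rfl fun j hj => ?_
    obtain ⟨c, hc⟩ := exists_rho_last_cyc_pow (K := K) D hx hj
    rw [hc]
    exact (normL_cyc_pow (rho_mem D j hmem) c).symm

end Norm

section Complexes

variable {k A M : Type*} [CommRing k] [Ring A] [Algebra k A] [AddCommGroup M] [Module k M]
  [Module A M] [Module Aᵐᵒᵖ M] [SMulCommClass A Aᵐᵒᵖ M] [IsScalarTower k A M]
  [IsScalarTower k Aᵐᵒᵖ M]

/-! ### The relations on the modules `X v m` -/

section Identities

theorem geom_sum_mul_of_pow_eq_one {R : Type*} [Ring R] {t : R} {m : ℕ} (h : t ^ m = 1) :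
    (∑ l ∈ Finset.range m, t ^ l) * t = ∑ l ∈ Finset.range m, t ^ l := by
  have h' := geom_sum_mul_neg t m
  rw [h, sub_self, mul_sub, mul_one, sub_eq_zero] at h'
  exact h'.symm

theorem mul_geom_sum_of_pow_eq_one {R : Type*} [Ring R] {t : R} {m : ℕ} (h : t ^ m = 1) :
    t * (∑ l ∈ Finset.range m, t ^ l) = ∑ l ∈ Finset.range m, t ^ l := by
  have h' := mul_neg_geom_sum t m
  rw [h, sub_self, sub_mul, one_mul, sub_eq_zero] at h'
  exact h'.symm

variable {K : Subalgebra k A}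

theorem hochOf_hochOf {L L' L'' : ℕ} (h : L = L' + 1) (h' : L' = L'' + 1) (z : Cyc M K L) :
    hochOf M K h' (hochOf M K h z) = 0 := by
  subst h'; subst h; exact hoch_hoch z

theorem hochOf_dL (D : BimoduleMul k A M) {L L' : ℕ} (h : L + 1 = L' + 1 + 1) (h' : L = L' + 1)
    (z : Cyc M K (L + 1)) :
    dL K D L' (hochOf M K h z) + hochOf M K h' (dL K D L z) = 0 := by
  subst h'; rw [add_comm]; exact hoch_dL D z

theorem hochOf_dPrimeL (D : BimoduleMul k A M) {L L' m : ℕ} (h : L + 1 = L' + 1 + 1)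
    (h' : L = L' + 1) {z : Cyc M K (L + 1)} (hz : z ∈ wordSpan M K (L + 1) m) :
    dPrimeL K D L' (hochOf M K h z) + hochOf M K h' (dPrimeL K D L z) = 0 := by
  subst h'; rw [add_comm]; exact hoch_dPrimeL D hz

theorem bX_bX (v m : ℕ) (z : X M K (v + 2) m) : bX M K v m (bX M K (v + 1) m z) = 0 :=
  Subtype.ext (hochOf_hochOf _ _ _)

theorem dX_dX (D : BimoduleMul k A M) (v m : ℕ) (z : X M K v (m + 2)) :
    dX K D v m (dX K D v (m + 1) z) = 0 :=
  Subtype.ext (dL_dL D _)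

theorem dPrimeX_dPrimeX (D : BimoduleMul k A M) (v m : ℕ) (z : X M K v (m + 2)) :
    dPrimeX K D v m (dPrimeX K D v (m + 1) z) = 0 :=
  Subtype.ext (dPrimeL_dPrimeL D _)

theorem dX_bX (D : BimoduleMul k A M) (v m : ℕ) (z : X M K (v + 1) (m + 1)) :
    dX K D v m (bX M K v (m + 1) z) = - bX M K v m (dX K D (v + 1) m z) :=
  eq_neg_of_add_eq_zero_left (Subtype.ext (hochOf_dL D (show v + 1 + m + 1 = v + m + 1 + 1 by omega)
    (show v + 1 + m = v + m + 1 by omega) z.1))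

theorem dPrimeX_bX (D : BimoduleMul k A M) (v m : ℕ) (z : X M K (v + 1) (m + 1)) :
    dPrimeX K D v m (bX M K v (m + 1) z) = - bX M K v m (dPrimeX K D (v + 1) m z) :=
  eq_neg_of_add_eq_zero_left (Subtype.ext (hochOf_dPrimeL D
    (show v + 1 + m + 1 = v + m + 1 + 1 by omega) (show v + 1 + m = v + m + 1 by omega) z.2))

/-- This is X_{v,-1} = 0. It settles the boundary cases in which division by m would be meaningless.
-/
instance (v : ℕ) : Subsingleton (X M K v 0) := by
  rw [X, wordSpan_zero]; infer_instance

theorem tX_pow_bX (v m j : ℕ) (z : X M K (v + 1) m) :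
    (tX M K v m ^ j) (bX M K v m z) = bX M K v m ((tX M K (v + 1) m ^ j) z) := by
  induction j with
  | zero => rfl
  | succ j ih => rw [pow_succ', pow_succ', Module.End.mul_apply, Module.End.mul_apply, ih, bX_tX]

theorem normX_bX (v m : ℕ) (z : X M K (v + 1) m) :
    normX M K v m (bX M K v m z) = bX M K v m (normX M K (v + 1) m z) := by
  simp only [normX, LinearMap.sum_apply, tX_pow_bX, map_sum]

theorem tX_pow_of_fixed {v m : ℕ} {z : X M K v m} (hz : tX M K v m z = z) (j : ℕ) :
    (tX M K v m ^ j) z = z := by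
  induction j with
  | zero => rfl
  | succ j ih => rw [pow_succ, Module.End.mul_apply, hz, ih]

theorem normX_of_fixed {v m : ℕ} {z : X M K v m} (hz : tX M K v m z = z) :
    normX M K v m z = (m : k) • z := by
  simp only [normX, LinearMap.sum_apply, tX_pow_of_fixed hz, Finset.sum_const, Finset.card_range,
    Nat.cast_smul_eq_nsmul]

theorem normX_mul_tX (v m : ℕ) : normX M K v m * tX M K v m = normX M K v m := by
  exact geom_sum_mul_of_pow_eq_one (R := Module.End k (X M K v m)) (tX_pow M K v m)

theorem tX_mul_normX (v m : ℕ) : tX M K v m * normX M K v m = normX M K v m := by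
  exact mul_geom_sum_of_pow_eq_one (R := Module.End k (X M K v m)) (tX_pow M K v m)

theorem normX_tX (v m : ℕ) (z : X M K v m) : normX M K v m (tX M K v m z) = normX M K v m z :=
  LinearMap.congr_fun (normX_mul_tX v m) z

theorem tX_normX (v m : ℕ) (z : X M K v m) : tX M K v m (normX M K v m z) = normX M K v m z :=
  LinearMap.congr_fun (tX_mul_normX v m) z

/-- The relation d(1 - t) = (1 - t)d′, evaluated at an invariant element. -/
theorem tX_dPrimeX_of_fixed (D : BimoduleMul k A M) {v m : ℕ} {z : X M K v (m + 1)}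
    (hz : tX M K v (m + 1) z = z) : tX M K v m (dPrimeX K D v m z) = dPrimeX K D v m z := by
  have h := dX_sub K D v m z
  rw [hz, sub_self, map_zero] at h
  exact (sub_eq_zero.1 h.symm).symm

theorem coe_normX (v m : ℕ) (z : X M K v m) :
    (normX M K v m z : Cyc M K (v + m)) = normL M K (v + m) m z := by
  have h : ∀ l : ℕ, ((tX M K v m ^ l) z : Cyc M K (v + m)) =
      (cyc ^ l : Module.End k (Cyc M K (v + m))) z := by
    intro l
    induction l with
    | zero => rfl
    | succ l ih => rw [pow_succ', pow_succ', Module.End.mul_apply, Module.End.mul_apply, ← ih]; rfl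
  simp only [normX, normL, LinearMap.sum_apply, Submodule.coe_sum, h]

theorem normX_dX_eq (D : BimoduleMul k A M) (v m : ℕ) (z : X M K v (m + 1)) :
    normX M K v m (dX K D v m z) = normX M K v m
      (dX K D v m (normX M K v (m + 1) z) - dPrimeX K D v m (normX M K v (m + 1) z)) := by
  apply Subtype.ext
  rw [coe_normX, coe_normX]
  refine (normL_dL D z.2).trans ?_
  congr 1
  have : ((dX K D v m (normX M K v (m + 1) z) - dPrimeX K D v m (normX M K v (m + 1) z) :
      X M K v m) : Cyc M K (v + m)) = dL K D (v + m) (normX M K v (m + 1) z).1 -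
        dPrimeL K D (v + m) (normX M K v (m + 1) z).1 := rfl
  rw [this, dL, LinearMap.add_apply, add_sub_cancel_left, coe_normX]
  rfl

end Identities

/-! ### Averaging over powers of `t`, and σ′ as a partial inverse of 1 - t -/

section Average

variable [Algebra ℚ k] {K : Subalgebra k A}

variable (k) in
theorem algebraMap_one_div_mul_cast {m : ℕ} (hm : m ≠ 0) :
    algebraMap ℚ k (1 / m) * (m : k) = 1 := by
  rw [← map_natCast (algebraMap ℚ k) m, ← map_mul, one_div_mul_cancel (Nat.cast_ne_zero.2 hm),
    map_one]

theorem natCast_smul_injective {V : Type*} [AddCommGroup V] [Module k V] {m : ℕ} (hm : m ≠ 0)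
    {x y : V} (h : (m : k) • x = (m : k) • y) : x = y := by
  have := congrArg (algebraMap ℚ k (1 / m) • ·) h
  simpa only [smul_smul, algebraMap_one_div_mul_cast k hm, one_smul] using this

/-- `N d = d' N`. -/
theorem normX_dX (D : BimoduleMul k A M) (v m : ℕ) (z : X M K v (m + 1)) :
    normX M K v m (dX K D v m z) = dPrimeX K D v m (normX M K v (m + 1) z) := by
  obtain _ | m := m
  · exact Subsingleton.elim _ _
  -- Put u = N z. Then N d z = N d u - N d′u. The same formula for u, with N u = (m + 2)u, gives N d
  -- u = (m + 2) N d z, and N d′u = (m + 1) d′u since d′u is invariant. Hence (m + 1) N d z = (m +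
  -- 1) d′u.
  have hN := tX_normX v (m + 1 + 1) z
  have h1 := normX_dX_eq D v (m + 1) z
  have h2 := normX_dX_eq D v (m + 1) (normX M K v (m + 1 + 1) z)
  have h3 := normX_of_fixed (tX_dPrimeX_of_fixed D hN)
  rw [normX_of_fixed hN, map_smul, map_smul] at h2
  replace h2 := h2.trans ((congrArg _ (smul_sub _ _ _).symm).trans (map_smul _ _ _))
  rw [← h1] at h2
  rw [map_sub, h2, h3, Nat.cast_succ, add_smul, one_smul] at h1
  apply natCast_smul_injective (k := k) m.succ_ne_zero
  rw [← sub_eq_zero] at h1 ⊢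
  rw [← neg_eq_zero, ← h1]
  abel

variable (M K) in
/-- The projection `N / m` of `X v m` onto its `t`-invariants. -/
def average (v m : ℕ) : Module.End k (X M K v m) := algebraMap ℚ k (1 / m) • normX M K v m

theorem average_apply (v m : ℕ) (z : X M K v m) :
    average M K v m z = algebraMap ℚ k (1 / m) • normX M K v m z := rfl

theorem tX_average (v m : ℕ) (z : X M K v m) :
    tX M K v m (average M K v m z) = average M K v m z := by
  rw [average_apply, map_smul, tX_normX]

theorem average_of_fixed {v m : ℕ} {z : X M K v m} (hz : tX M K v m z = z) :
    average M K v m z = z := by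
  obtain _ | m := m
  · exact Subsingleton.elim _ _
  rw [average_apply, normX_of_fixed hz, smul_smul, algebraMap_one_div_mul_cast k m.succ_ne_zero,
    one_smul]

theorem average_average (v m : ℕ) (z : X M K v m) :
    average M K v m (average M K v m z) = average M K v m z :=
  average_of_fixed (tX_average v m z)

theorem average_tX (v m : ℕ) (z : X M K v m) :
    average M K v m (tX M K v m z) = average M K v m z := by
  rw [average_apply, normX_tX, average_apply]

theorem average_bX (v m : ℕ) (z : X M K (v + 1) m) :
    average M K v m (bX M K v m z) = bX M K v m (average M K (v + 1) m z) := by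
  rw [average_apply, average_apply, map_smul, normX_bX]

theorem normBar_pBar (v m : ℕ) (z : X M K v m) :
    normBar M K v m (pBar M K v m z) = average M K v m z := by
  rw [pBar, LinearMap.smul_apply, map_smul, average_apply]
  rfl

theorem tX_normBar (v m : ℕ) (x : XBar M K v m) :
    tX M K v m (normBar M K v m x) = normBar M K v m x := by
  obtain ⟨z, rfl⟩ := Submodule.mkQ_surjective _ x
  exact tX_normX v m z

theorem pBar_tX (v m : ℕ) (z : X M K v m) : pBar M K v m (tX M K v m z) = pBar M K v m z := by
  rw [pBar, LinearMap.smul_apply, LinearMap.smul_apply]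
  congr 1
  rw [← sub_eq_zero, ← map_sub, Submodule.mkQ_apply, Submodule.Quotient.mk_eq_zero]
  exact ⟨-z, by simp; abel⟩

/-- Modulo 1 - t all powers of `t` agree, so N is multiplication by the number of its terms, which
the factor in 𝔭 cancels. With `normBar_pBar` this identifies X̄ with the invariants of `t`. -/
theorem pBar_normBar (v m : ℕ) (x : XBar M K v m) : pBar M K v m (normBar M K v m x) = x := by
  obtain ⟨z, rfl⟩ := Submodule.mkQ_surjective _ x
  obtain _ | m := m
  · rw [Subsingleton.elim z 0]; simp
  have hp : ∀ j, pBar M K v (m + 1) ((tX M K v (m + 1) ^ j) z) = pBar M K v (m + 1) z := by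
    intro j
    induction j with
    | zero => rfl
    | succ j ih => rw [pow_succ', Module.End.mul_apply, pBar_tX, ih]
  change pBar M K v (m + 1) (normX M K v (m + 1) z) = _
  rw [normX, LinearMap.sum_apply, map_sum]
  simp only [hp, Finset.sum_const, Finset.card_range]
  rw [← Nat.cast_smul_eq_nsmul k, pBar, LinearMap.smul_apply, smul_smul, mul_comm,
    algebraMap_one_div_mul_cast k m.succ_ne_zero, one_smul]

theorem normBar_injective (v m : ℕ) : Function.Injective (normBar M K v m) :=
  Function.LeftInverse.injective (pBar_normBar v m)

theorem normBar_bBar (v m : ℕ) (x : XBar M K (v + 1) m) :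
    normBar M K v m (bBar M K v m x) = bX M K v m (normBar M K (v + 1) m x) := by
  obtain ⟨z, rfl⟩ := Submodule.mkQ_surjective _ x
  exact normX_bX v m z

/-- On the invariants the induced differential is d′, although d̄ is defined from d. -/
theorem normBar_dBar (D : BimoduleMul k A M) (v m : ℕ) (x : XBar M K v (m + 1)) :
    normBar M K v m (dBar K D v m x) = dPrimeX K D v m (normBar M K v (m + 1) x) := by
  obtain ⟨z, rfl⟩ := Submodule.mkQ_surjective _ x
  exact normX_dX D v m z

/-- Passing from n to n + 1 adds a geometric sum to the left factor, and its product with 1 - t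
telescopes. Divided by n + 1, the left factor is σ′. -/
theorem sum_range_sub_smul_pow_mul {R : Type*} [Ring R] (t : R) (n : ℕ) :
    (∑ j ∈ Finset.range n, ((n : R) - j) * t ^ j) * (1 - t) =
      (n + 1 : R) - ∑ j ∈ Finset.range (n + 1), t ^ j := by
  induction n with
  | zero => simp
  | succ n ih =>
    have h : ∑ j ∈ Finset.range (n + 1), (((n + 1 : ℕ) : R) - j) * t ^ j =
        ∑ j ∈ Finset.range n, ((n : R) - j) * t ^ j + ∑ j ∈ Finset.range (n + 1), t ^ j := by
      rw [Finset.sum_range_succ, Finset.sum_range_succ (fun j => t ^ j), ← add_assoc,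
        ← Finset.sum_add_distrib]
      congr 1
      · refine Finset.sum_congr rfl fun j _ => ?_
        rw [Nat.cast_succ]; noncomm_ring
      · simp
    rw [h, add_mul, ih, geom_sum_mul_neg, Finset.sum_range_succ _ (n + 1), Nat.cast_succ]
    abel

theorem sum_range_smul_eq {R : Type*} [Ring R] [Algebra k R] (t : R) (m : ℕ) :
    ∑ j ∈ Finset.range m, algebraMap ℚ k ((((m + 1 : ℕ) : ℚ) - 1 - j) / (m + 1 : ℕ)) • t ^ j =
      algebraMap ℚ k (1 / (m + 1 : ℕ)) • ∑ j ∈ Finset.range m, ((m : R) - j) * t ^ j := by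
  rw [Finset.smul_sum]
  refine Finset.sum_congr rfl fun j _ => ?_
  have h : (((m + 1 : ℕ) : ℚ) - 1 - j) / (m + 1 : ℕ) = 1 / (m + 1 : ℕ) * ((m : ℚ) - j) := by
    push_cast; ring
  rw [h, map_mul, mul_smul, map_sub, map_natCast, map_natCast, sub_smul, sub_mul]
  simp only [Nat.cast_smul_eq_nsmul, nsmul_eq_mul]

theorem sigmaPrime_tX (v m : ℕ) (z : X M K v m) :
    sigmaPrime M K v m (tX M K v m z) = tX M K v m (sigmaPrime M K v m z) := by
  simp only [sigmaPrime, LinearMap.sum_apply, map_sum, LinearMap.smul_apply, map_smul]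
  refine Finset.sum_congr rfl fun j _ => ?_
  rw [← Module.End.mul_apply, ← pow_succ, pow_succ', Module.End.mul_apply]

theorem sigmaPrime_bX (v m : ℕ) (z : X M K (v + 1) m) :
    sigmaPrime M K v m (bX M K v m z) = bX M K v m (sigmaPrime M K (v + 1) m z) := by
  simp only [sigmaPrime, LinearMap.sum_apply, map_sum, LinearMap.smul_apply, map_smul, tX_pow_bX]

/-- `σ' (1 - t) = 1 - N / m`. -/
theorem sigmaPrime_sub_tX (v m : ℕ) (z : X M K v m) :
    sigmaPrime M K v m (z - tX M K v m z) = z - average M K v m z := by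
  obtain _ | m := m
  · exact Subsingleton.elim _ _
  have hs : sigmaPrime M K v (m + 1) = algebraMap ℚ k (1 / (m + 1 : ℕ)) •
      ∑ j ∈ Finset.range m, ((m : Module.End k (X M K v (m + 1))) - j) * tX M K v (m + 1) ^ j :=
    sum_range_smul_eq (R := Module.End k (X M K v (m + 1))) (tX M K v (m + 1)) m
  have h := LinearMap.congr_fun
    (sum_range_sub_smul_pow_mul (R := Module.End k (X M K v (m + 1))) (tX M K v (m + 1)) m) z
  rw [hs, LinearMap.smul_apply, average_apply]
  change _ • ((∑ j ∈ Finset.range m, ((m : Module.End k (X M K v (m + 1))) - j) *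
    tX M K v (m + 1) ^ j) * (1 - tX M K v (m + 1))) z = _
  rw [h]
  change algebraMap ℚ k (1 / (m + 1 : ℕ)) •
    (((m : Module.End k (X M K v (m + 1))) + 1) z - normX M K v (m + 1) z) = _
  have hc : ((m : Module.End k (X M K v (m + 1))) + 1) z = ((m + 1 : ℕ) : k) • z := by
    rw [Nat.cast_smul_eq_nsmul, ← Nat.cast_succ, Module.End.natCast_apply]
  rw [hc, smul_sub, smul_smul, algebraMap_one_div_mul_cast k m.succ_ne_zero, one_smul]

/-- Each power of `t` acts as the identity on invariants, so r is the sum of the coefficients of σ′.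
Its value plays no role. -/
theorem sigmaPrime_of_fixed (v m : ℕ) : ∃ r : k, ∀ z : X M K v m, tX M K v m z = z →
    sigmaPrime M K v m z = r • z := by
  refine ⟨∑ j ∈ Finset.range (m - 1), algebraMap ℚ k (((m : ℚ) - 1 - j) / m), fun z hz => ?_⟩
  simp only [sigmaPrime, LinearMap.sum_apply, LinearMap.smul_apply, tX_pow_of_fixed hz,
    Finset.sum_smul]

theorem average_sigmaPrime (v m : ℕ) (z : X M K v m) :
    average M K v m (sigmaPrime M K v m z) = sigmaPrime M K v m (average M K v m z) := by
  obtain ⟨r, hr⟩ := sigmaPrime_of_fixed (M := M) (K := K) v m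
  rw [hr _ (tX_average v m z), ← map_smul]
  have h : ∀ j, average M K v m ((tX M K v m ^ j) z) = average M K v m z := by
    intro j
    induction j with
    | zero => rfl
    | succ j ih => rw [pow_succ', Module.End.mul_apply, average_tX, ih]
  rw [map_smul, ← hr _ (tX_average v m z)]
  simp only [sigmaPrime, LinearMap.sum_apply, map_sum, LinearMap.smul_apply, map_smul, h,
    tX_pow_of_fixed (tX_average v m z)]

theorem sub_tX_sigmaPrime (v m : ℕ) (z : X M K v m) :
    sigmaPrime M K v m z - tX M K v m (sigmaPrime M K v m z) = z - average M K v m z := by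
  rw [← sigmaPrime_sub_tX, map_sub, sigmaPrime_tX]

end Average

end Complexes

/-! ### The Fitting decomposition for the Karoubi operator -/

section Harmonic

/-- Coprime commuting factors of zero give a Fitting decomposition. -/
theorem isCompl_ker_range_of_isCoprime {k V : Type*} [CommRing k] [AddCommGroup V] [Module k V]
    (f : Module.End k V) {p q : Polynomial k} (h : IsCoprime p q)
    (h0 : Polynomial.aeval f (p * q) = 0) :
    IsCompl (LinearMap.ker (Polynomial.aeval f p)) (LinearMap.range (Polynomial.aeval f p)) := by
  obtain ⟨a, b, hab⟩ := h
  -- In the Bézout decomposition of x the first summand lies in the range of p(f), and the second in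
  -- its kernel because (pq)(f) = 0.
  have hab' : ∀ x, Polynomial.aeval f (a * p) x + Polynomial.aeval f (b * q) x = x := by
    intro x
    rw [← LinearMap.add_apply, ← map_add, hab, map_one, Module.End.one_apply]
  constructor
  · rw [Submodule.disjoint_def]
    rintro _ hx ⟨y, rfl⟩
    rw [← hab' (Polynomial.aeval f p y), map_mul, Module.End.mul_apply, LinearMap.mem_ker.1 hx,
      map_zero, zero_add, ← Module.End.mul_apply, ← map_mul, mul_assoc, mul_comm q, map_mul, h0,
      mul_zero, LinearMap.zero_apply]
  · rw [codisjoint_iff, eq_top_iff]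
    intro x _
    rw [← hab' x, add_comm]
    refine Submodule.add_mem_sup ?_ ?_
    · rw [LinearMap.mem_ker, ← Module.End.mul_apply, ← map_mul, mul_left_comm, map_mul, h0,
        mul_zero, LinearMap.zero_apply]
    · rw [mul_comm, map_mul, Module.End.mul_apply]
      exact LinearMap.mem_range_self _ _

/-- At X = 1 the geometric sum takes the value m, a unit of `k`. -/
theorem isCoprime_X_sub_one_geom_sum {k : Type*} [CommRing k] [Algebra ℚ k] {m : ℕ} (hm : m ≠ 0) :
    IsCoprime (Polynomial.X - 1 : Polynomial k) (∑ l ∈ Finset.range m, Polynomial.X ^ l) := by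
  have h1 : (Polynomial.X - 1 : Polynomial k) ∣
      (∑ l ∈ Finset.range m, Polynomial.X ^ l) - Polynomial.C (m : k) := by
    rw [← Polynomial.C_1, Polynomial.dvd_iff_isRoot]
    simp [Polynomial.eval_finsetSum]
  obtain ⟨q, hq⟩ := h1
  refine ⟨-(Polynomial.C (algebraMap ℚ k (1 / m)) * q), Polynomial.C (algebraMap ℚ k (1 / m)), ?_⟩
  rw [sub_eq_iff_eq_add] at hq
  rw [hq, mul_add, ← Polynomial.C_mul, algebraMap_one_div_mul_cast k hm, Polynomial.C_1]
  ring

/-- Each of the two factors of the annihilating polynomial contains X - 1 once, with a geometric sum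
coprime to it as cofactor. -/
theorem isCompl_ker_range_sub_one_sq {k V : Type*} [CommRing k] [Algebra ℚ k] [AddCommGroup V]
    [Module k V] (f : Module.End k V) {m : ℕ} (hm : m ≠ 0)
    (h : (f ^ m - 1) * (f ^ (m + 1) - 1) = 0) :
    IsCompl (LinearMap.ker ((f - 1) ^ 2)) (LinearMap.range ((f - 1) ^ 2)) := by
  have h' : (f - 1) ^ 2 = Polynomial.aeval f ((Polynomial.X - 1 : Polynomial k) ^ 2) := by simp
  rw [h']
  refine isCompl_ker_range_of_isCoprime _ (q := (∑ l ∈ Finset.range m, Polynomial.X ^ l) *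
    ∑ l ∈ Finset.range (m + 1), Polynomial.X ^ l)
    (((isCoprime_X_sub_one_geom_sum hm).mul_right
      (isCoprime_X_sub_one_geom_sum m.succ_ne_zero)).pow_left) ?_
  have e : ((Polynomial.X - 1 : Polynomial k) ^ 2 * ((∑ l ∈ Finset.range m, Polynomial.X ^ l) *
      ∑ l ∈ Finset.range (m + 1), Polynomial.X ^ l)) =
      (Polynomial.X ^ m - 1) * (Polynomial.X ^ (m + 1) - 1) := by
    rw [← geom_sum_mul, ← geom_sum_mul]; ring
  rw [e, map_mul, map_sub, map_sub, map_pow, map_pow, Polynomial.aeval_X, map_one, h]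

variable {k A M : Type*} [CommRing k] [Ring A] [Algebra k A] [AddCommGroup M] [Module k M]
  [Module A M] [Module Aᵐᵒᵖ M] [SMulCommClass A Aᵐᵒᵖ M] [IsScalarTower k A M]
  [IsScalarTower k Aᵐᵒᵖ M] {K : Subalgebra k A} (D : BimoduleMul k A M)

theorem karoubi_apply (v w : ℕ) (z : DDotX M K v w) :
    karoubi K D v w z = (tX M K v (w + 1) z.1,
      tX M K v w z.2 + (dPrimeX K D v w z.1 - dX K D v w z.1)) := rfl

theorem karoubi_pow_apply (v w l : ℕ) (z : DDotX M K v w) :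
    (((karoubi K D v w) ^ l) z).1 = (tX M K v (w + 1) ^ l) z.1 := by
  induction l with
  | zero => rfl
  | succ l ih => rw [pow_succ', pow_succ', Module.End.mul_apply, Module.End.mul_apply, ← ih]; rfl

theorem karoubi_pow_apply_zero (v w l : ℕ) (y : X M K v w) :
    ((karoubi K D v w) ^ l) (0, y) = (0, (tX M K v w ^ l) y) := by
  induction l with
  | zero => rfl
  | succ l ih =>
    rw [pow_succ', pow_succ', Module.End.mul_apply, Module.End.mul_apply, ih, karoubi_apply]
    simp

/-- On the first component κ̈ is `t` with t^(w+1) = 1, so κ̈^(w+1) - 1 lands in the second summand.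
There κ̈ is `t` with t^w = 1. -/
theorem karoubi_pow_sub_one_mul (v w : ℕ) :
    ((karoubi K D v w) ^ w - 1) * ((karoubi K D v w) ^ (w + 1) - 1) = 0 := by
  refine LinearMap.ext fun z => ?_
  have h : ((karoubi K D v w) ^ (w + 1) - 1) z =
      (0, (((karoubi K D v w) ^ (w + 1) - 1) z).2) := by
    refine Prod.ext ?_ rfl
    rw [LinearMap.sub_apply, Prod.fst_sub, karoubi_pow_apply, tX_pow]
    exact sub_self z.1
  rw [Module.End.mul_apply, h, LinearMap.sub_apply, karoubi_pow_apply_zero, tX_pow]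
  exact sub_self _

theorem isCompl_karoubi [Algebra ℚ k] (v w : ℕ) :
    IsCompl (LinearMap.ker ((karoubi K D v w - 1) ^ 2))
      (LinearMap.range ((karoubi K D v w - 1) ^ 2)) := by
  -- For w = 0 the annihilating polynomial is zero and says nothing, but then κ̈ is the identity:
  -- the second summand vanishes, and t = 1 on words with one letter in M.
  obtain _ | w := w
  · have h : (karoubi K D v 0 - 1) = 0 := by
      refine LinearMap.ext fun z => Prod.ext ?_ (Subsingleton.elim _ _)
      have := LinearMap.congr_fun (tX_pow M K v 1) z.1
      rw [pow_one] at this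
      exact (congrArg (· - z.1) this).trans (sub_self z.1)
    rw [h, zero_pow two_ne_zero, LinearMap.ker_zero, LinearMap.range_zero]
    exact isCompl_top_bot
  · exact isCompl_ker_range_sub_one_sq _ w.succ_ne_zero (karoubi_pow_sub_one_mul D v (w + 1))

theorem harmonicPart_eq_ker [Algebra ℚ k] (v w : ℕ) :
    harmonicPart K D v w = LinearMap.ker ((karoubi K D v w - 1) ^ 2) := by
  rw [harmonicPart, harmonicProj, dif_pos (isCompl_karoubi D v w), Submodule.range_projection]

end Harmonic

/-! ### The double mixed complex Ẍ and the map Ψ onto its harmonic part -/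

section DoubleDot

variable {k A M : Type*} [CommRing k] [Algebra ℚ k] [Ring A] [Algebra k A] [AddCommGroup M]
  [Module k M] [Module A M] [Module Aᵐᵒᵖ M] [SMulCommClass A Aᵐᵒᵖ M] [IsScalarTower k A M]
  [IsScalarTower k Aᵐᵒᵖ M] {K : Subalgebra k A} (D : BimoduleMul k A M)

theorem bDD_apply (v w : ℕ) (z : DDotX M K (v + 1) w) :
    bDD M K v w z = (bX M K v (w + 1) z.1, -bX M K v w z.2) := rfl

theorem BDD_apply (v w : ℕ) (z : DDotX M K v w) :
    BDD M K v w z = (0, normX M K v (w + 1) z.1) := rfl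

theorem dDD_apply (v w : ℕ) (z : DDotX M K v (w + 1)) :
    dDD K D v w z = (dX K D v (w + 1) z.1 + (z.2 - tX M K v (w + 1) z.2),
      -dPrimeX K D v w z.2) := rfl

theorem neg_bX_normX_add (v m : ℕ) (z : X M K (v + 1) m) :
    -bX M K v m (normX M K (v + 1) m z) + normX M K v m (bX M K v m z) = 0 := by
  rw [normX_bX, neg_add_cancel]

/-- Besides the squares and anticommutators of b, d and d′, the law d̈² = 0 uses d(1 - t) = (1 -
t)d′, and d̈B̈ + B̈d̈ = 0 uses N d = d′N and (1 - t)N = N(1 - t) = 0. -/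
theorem isDoubleMixedComplex_dDotX : IsDoubleMixedComplex (k := k) (X := DDotX M K) (bDD M K)
    (dDD K D) (BDD M K) where
  b_b v w z := by
    refine Prod.ext (bX_bX v (w + 1) z.1) ?_
    change -bX M K v w (-bX M K (v + 1) w z.2) = 0
    rw [map_neg, neg_neg, bX_bX]
  β_β v w z := by
    refine Prod.ext ?_ ?_
    · change dX K D v (w + 1) (dX K D v (w + 2) z.1 + (z.2 - tX M K v (w + 2) z.2)) +
        (-dPrimeX K D v (w + 1) z.2 - tX M K v (w + 1) (-dPrimeX K D v (w + 1) z.2)) = 0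
      rw [map_add, dX_dX, dX_sub, map_neg]
      abel
    · change -dPrimeX K D v w (-dPrimeX K D v (w + 1) z.2) = 0
      rw [map_neg, neg_neg, dPrimeX_dPrimeX]
  B_B v w z := Prod.ext rfl (map_zero (normX M K v (w + 2)))
  β_b v w z := by
    refine Prod.ext ?_ ?_
    · change dX K D v (w + 1) (bX M K v (w + 2) z.1) +
        (-bX M K v (w + 1) z.2 - tX M K v (w + 1) (-bX M K v (w + 1) z.2)) +
        bX M K v (w + 1) (dX K D (v + 1) (w + 1) z.1 + (z.2 - tX M K (v + 1) (w + 1) z.2)) = 0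
      rw [dX_bX, map_neg, ← bX_tX, map_add, map_sub]
      abel
    · change -dPrimeX K D v w (-bX M K v (w + 1) z.2) + -bX M K v w (-dPrimeX K D (v + 1) w z.2) = 0
      rw [map_neg, map_neg, dPrimeX_bX]
      abel
  β_B v w z := by
    refine Prod.ext ?_ ?_
    · change dX K D v (w + 2) 0 + (normX M K v (w + 2) z.1 -
        tX M K v (w + 2) (normX M K v (w + 2) z.1)) + 0 = 0
      rw [tX_normX, map_zero]
      abel
    · change -dPrimeX K D v (w + 1) (normX M K v (w + 2) z.1) +
        normX M K v (w + 1) (dX K D v (w + 1) z.1 + (z.2 - tX M K v (w + 1) z.2)) = 0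
      rw [map_add, normX_dX, map_sub, normX_tX]
      abel
  β_B_zero v z := by
    refine Prod.ext ?_ (Subsingleton.elim _ _)
    change dX K D v 1 0 + (normX M K v 1 z.1 - tX M K v 1 (normX M K v 1 z.1)) = 0
    rw [tX_normX, map_zero]
    abel
  b_B v w z := by
    refine Prod.ext ((add_zero _).trans (map_zero (bX M K v (w + 1 + 1)))) ?_
    exact neg_bX_normX_add v (w + 1) z.1

theorem upsilon_apply (v m : ℕ) (z : X M K v (m + 1)) :
    upsilon K D v m z = -sigmaPrime M K v m (dX K D v m z) +
      average M K v m (sigmaPrime M K v m (dX K D v m z)) := by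
  rw [← normBar_pBar]; rfl

theorem upsilon_bX (v m : ℕ) (z : X M K (v + 1) (m + 1)) :
    upsilon K D v m (bX M K v (m + 1) z) = - bX M K v m (upsilon K D (v + 1) m z) := by
  rw [upsilon_apply, upsilon_apply, dX_bX, map_neg, map_neg, sigmaPrime_bX, average_bX, map_add,
    map_neg]
  abel

/-- This equation is the purpose of Υ. It places (u, Υ u), for invariant u, in ker (κ̈ - 1)², and
makes the first component of d̈(u, Υ u) the average of d u. -/
theorem tX_sub_upsilon (v m : ℕ) (z : X M K v (m + 1)) :
    tX M K v m (upsilon K D v m z) - upsilon K D v m z =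
      dX K D v m z - average M K v m (dX K D v m z) := by
  rw [← sub_tX_sigmaPrime, upsilon_apply, map_add, map_neg, tX_average]
  abel

theorem average_dX_of_fixed {v m : ℕ} {u : X M K v (m + 1)} (hu : tX M K v (m + 1) u = u) :
    average M K v m (dX K D v m u) =
      algebraMap ℚ k (1 / m) • ((m + 1 : ℕ) : k) • dPrimeX K D v m u := by
  rw [average_apply, normX_dX, normX_of_fixed hu, map_smul]

/-- The origin of ξ̄. With y = σ′d u the left side is d′y. The two terms on the right are the part
of d′y with average zero and the average of d′y. -/
theorem dPrimeX_upsilon {v m : ℕ} {u : X M K v (m + 2)} (hu : tX M K v (m + 2) u = u) :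
    -dPrimeX K D v m (upsilon K D v (m + 1) u) =
      upsilon K D v m (average M K v (m + 1) (dX K D v (m + 1) u)) +
        average M K v m (dPrimeX K D v m (sigmaPrime M K v (m + 1) (dX K D v (m + 1) u))) := by
  set y := sigmaPrime M K v (m + 1) (dX K D v (m + 1) u) with hy
  -- The average of y is a multiple of that of d u, hence of d′u, and d′ squares to zero.
  have h1 : dPrimeX K D v m (average M K v (m + 1) y) = 0 := by
    obtain ⟨r, hr⟩ := sigmaPrime_of_fixed (M := M) (K := K) v (m + 1)
    rw [hy, average_sigmaPrime, hr _ (tX_average _ _ _), average_dX_of_fixed D hu]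
    simp only [map_smul, dPrimeX_dPrimeX, smul_zero]
  have h2 : average M K v (m + 1) (dX K D v (m + 1) u) =
      dX K D v (m + 1) u - (y - tX M K v (m + 1) y) := by
    rw [hy, sub_tX_sigmaPrime]; abel
  have h3 : sigmaPrime M K v m (dX K D v m (average M K v (m + 1) (dX K D v (m + 1) u))) =
      -(dPrimeX K D v m y - average M K v m (dPrimeX K D v m y)) := by
    rw [h2, map_sub, dX_dX, dX_sub, zero_sub, map_neg, sigmaPrime_sub_tX]
  rw [upsilon_apply, ← hy, upsilon_apply D v m, h3, map_add, h1, map_neg, map_neg, map_sub,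
    average_average]
  abel

/-- With the scalar moved inside Υ, Ψ takes the form (u, Υ u + N̄ y), where u = N̄ x / (w + 1) is
invariant. -/
theorem Psi_apply (v w : ℕ) (z : TildeX M K v w) :
    Psi K D v w z =
      (algebraMap ℚ k (1 / (w + 1 : ℕ)) • normBar M K v (w + 1) z.1,
        upsilon K D v w (algebraMap ℚ k (1 / (w + 1 : ℕ)) • normBar M K v (w + 1) z.1) +
          normBar M K v w z.2) := by
  rw [map_smul, Nat.cast_succ]
  exact Prod.ext (add_zero _) rfl

theorem tX_smul_normBar (v m : ℕ) (r : k) (x : XBar M K v m) :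
    tX M K v m (r • normBar M K v m x) = r • normBar M K v m x := by
  rw [map_smul, tX_normBar]

theorem Psi_injective (v w : ℕ) : Function.Injective (Psi K D v w) := by
  rw [injective_iff_map_eq_zero]
  intro z hz
  rw [Psi_apply] at hz
  have h1 : algebraMap ℚ k (1 / (w + 1 : ℕ)) • normBar M K v (w + 1) z.1 = 0 :=
    congrArg Prod.fst hz
  have h2 := congrArg Prod.snd hz
  simp only [h1, map_zero, zero_add, Prod.snd_zero] at h2
  refine Prod.ext (normBar_injective _ _ ?_) (normBar_injective _ _ (h2.trans (map_zero _).symm))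
  have h3 := congrArg (((w + 1 : ℕ) : k) • ·) h1
  simp only [smul_smul, smul_zero, mul_comm ((w + 1 : ℕ) : k),
    algebraMap_one_div_mul_cast k w.succ_ne_zero, one_smul] at h3
  exact h3.trans (map_zero _).symm

theorem bDD_Psi (v w : ℕ) (z : TildeX M K (v + 1) w) :
    bDD M K v w (Psi K D (v + 1) w z) = Psi K D v w (bTilde M K v w z) := by
  have h1 : (bTilde M K v w z).1 = bBar M K v (w + 1) z.1 := rfl
  have h2 : (bTilde M K v w z).2 = -bBar M K v w z.2 := rfl
  rw [Psi_apply, Psi_apply, bDD_apply, h1, h2, normBar_bBar, ← map_smul (bX M K v (w + 1)),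
    upsilon_bX, map_neg, normBar_bBar, map_add, neg_add]

theorem BDD_Psi (v w : ℕ) (z : TildeX M K v w) :
    BDD M K v w (Psi K D v w z) = Psi K D v (w + 1) (BTilde M K v w z) := by
  rw [Psi_apply, Psi_apply]
  have h0 : normBar M K v (w + 1 + 1) (BTilde M K v w z).1 = 0 := map_zero _
  rw [h0, smul_zero, map_zero, zero_add]
  rw [BDD_apply, map_smul, ← average_apply, average_of_fixed (tX_normBar v (w + 1) z.1)]
  rfl

theorem normBar_xiBar (v w : ℕ) (x : XBar M K v (w + 2)) :
    normBar M K v w (xiBar K D v w x) =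
      average M K v w (dPrimeX K D v w (sigmaPrime M K v (w + 1) (dX K D v (w + 1)
        (algebraMap ℚ k (1 / (w + 2 : ℕ)) • normBar M K v (w + 2) x)))) := by
  simp only [map_smul]
  rw [← normBar_pBar, ← map_smul, Nat.cast_add, Nat.cast_two]
  rfl

theorem dDD_Psi (v w : ℕ) (z : TildeX M K v (w + 1)) :
    dDD K D v w (Psi K D v (w + 1) z) =
      Psi K D v w ((dTilde K D v w + xiTilde K D v w) z) := by
  rw [Psi_apply, Psi_apply]
  set u := algebraMap ℚ k (1 / (w + 1 + 1 : ℕ)) • normBar M K v (w + 1 + 1) z.1 with hu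
  have hut : tX M K v (w + 2) u = u := tX_smul_normBar _ _ _ _
  have h1 : ((dTilde K D v w + xiTilde K D v w) z).1 = dBar K D v (w + 1) z.1 := add_zero _
  have h2 : ((dTilde K D v w + xiTilde K D v w) z).2 = -dBar K D v w z.2 + xiBar K D v w z.1 := rfl
  -- The normalisation of Ψ matters here: N d u = d′N u = (w + 2) d′u, and (w + 2)u is the unscaled
  -- N̄ of the first component.
  have h3 : algebraMap ℚ k (1 / (w + 1 : ℕ)) • normBar M K v (w + 1) (dBar K D v (w + 1) z.1) =
      average M K v (w + 1) (dX K D v (w + 1) u) := by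
    rw [average_apply, normX_dX, normX_of_fixed hut, normBar_dBar, hu, smul_smul _ (algebraMap ℚ k _),
      mul_comm ((w + 1 + 1 : ℕ) : k), algebraMap_one_div_mul_cast k (w + 1).succ_ne_zero, one_smul]
  rw [h1, h2, h3, map_add, map_neg, normBar_dBar, normBar_xiBar, ← hu]
  have h4 := tX_sub_upsilon D v (w + 1) u
  rw [dDD_apply]
  refine Prod.ext ?_ ?_
  · simp only [map_add, tX_normBar]
    rw [add_sub_add_right_eq_sub, ← neg_sub, h4]
    abel
  · simp only [map_add, neg_add, dPrimeX_upsilon D hut]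
    abel

theorem karoubi_sub_one_apply (v w : ℕ) (z : DDotX M K v w) :
    (karoubi K D v w - 1) z = (tX M K v (w + 1) z.1 - z.1,
      tX M K v w z.2 - z.2 + (dPrimeX K D v w z.1 - dX K D v w z.1)) := by
  refine Prod.ext rfl ?_
  exact add_sub_right_comm _ _ _

/-- One application of κ̈ - 1 leaves only a second component d′u minus the average of d u. This is
invariant, so a second application kills it. -/
theorem Psi_mem (v w : ℕ) (z : TildeX M K v w) : Psi K D v w z ∈ harmonicPart K D v w := by
  rw [harmonicPart_eq_ker, LinearMap.mem_ker, pow_two, Module.End.mul_apply, Psi_apply]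
  set u := algebraMap ℚ k (1 / (w + 1 : ℕ)) • normBar M K v (w + 1) z.1
  have hut : tX M K v (w + 1) u = u := tX_smul_normBar _ _ _ _
  have h : (karoubi K D v w - 1) (u, upsilon K D v w u + normBar M K v w z.2) =
      (0, dPrimeX K D v w u - average M K v w (dX K D v w u)) := by
    rw [karoubi_sub_one_apply]
    refine Prod.ext (sub_eq_zero.2 hut) ?_
    have := tX_sub_upsilon D v w u
    change tX M K v w (upsilon K D v w u + normBar M K v w z.2) -
      (upsilon K D v w u + normBar M K v w z.2) + (dPrimeX K D v w u - dX K D v w u) = _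
    rw [map_add, tX_normBar, add_sub_add_right_eq_sub, this]
    change _ = dPrimeX K D v w u - average M K v w (dX K D v w u)
    abel
  rw [h, karoubi_sub_one_apply]
  simp only [map_zero, map_sub, tX_average, tX_dPrimeX_of_fixed D hut]
  refine Prod.ext ?_ ?_
  · exact sub_zero 0
  · change _ - _ + ((0 : X M K v w) - 0) = 0
    abel

/-- An invariant element equals its average, and the average of (t - 1)z is zero. -/
theorem fixed_of_sub_fixed {v m : ℕ} {z : X M K v m}
    (h : tX M K v m (tX M K v m z - z) = tX M K v m z - z) : tX M K v m z = z := by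
  have h' := average_of_fixed h
  rw [map_sub, average_tX, sub_self] at h'
  exact sub_eq_zero.1 h'.symm

/-- The first component x of a harmonic pair is invariant. The second one then satisfies the same
equation as Υ x, so it differs from Υ x by an invariant element. -/
theorem exists_Psi_eq {v w : ℕ} {z : DDotX M K v w} (hz : z ∈ harmonicPart K D v w) :
    ∃ y, Psi K D v w y = z := by
  rw [harmonicPart_eq_ker, LinearMap.mem_ker, pow_two, Module.End.mul_apply] at hz
  obtain ⟨x, y⟩ := z
  rw [karoubi_sub_one_apply, karoubi_sub_one_apply] at hz
  have h1 : tX M K v (w + 1) x = x := fixed_of_sub_fixed (sub_eq_zero.1 (congrArg Prod.fst hz))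
  have h2 := congrArg Prod.snd hz
  simp only [h1, sub_self, map_zero, add_zero, Prod.snd_zero] at h2
  -- The invariant element (t - 1)y + d′x - d x equals its average, which is d′x minus the average
  -- of d x.
  have h3 := average_of_fixed (sub_eq_zero.1 h2)
  rw [map_add, map_sub, average_tX, sub_self, zero_add, map_sub,
    average_of_fixed (tX_dPrimeX_of_fixed D h1)] at h3
  have h4 : tX M K v w (y - upsilon K D v w x) = y - upsilon K D v w x := by
    have h5 := tX_sub_upsilon D v w x
    rw [map_sub, ← sub_eq_zero]
    rw [← sub_eq_zero] at h3 h5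
    have h6 := congrArg₂ (· + ·) h3 h5
    simp only [add_zero] at h6
    rw [← neg_eq_zero, ← h6]
    abel
  -- The factor w + 1 compensates the normalisation of the first component of Ψ.
  refine ⟨(((w + 1 : ℕ) : k) • pBar M K v (w + 1) x, pBar M K v w (y - upsilon K D v w x)), ?_⟩
  rw [Psi_apply]
  have h7 : algebraMap ℚ k (1 / (w + 1 : ℕ)) •
      normBar M K v (w + 1) (((w + 1 : ℕ) : k) • pBar M K v (w + 1) x) = x := by
    rw [map_smul, smul_smul, algebraMap_one_div_mul_cast k w.succ_ne_zero, one_smul, normBar_pBar,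
      average_of_fixed h1]
  simp only [h7, normBar_pBar, average_of_fixed h4]
  rw [add_sub_cancel]

end DoubleDot

/-! ### Pulling back the laws of a double mixed complex -/

section Transfer

variable {k : Type*} [CommRing k] {X Y : ℕ → ℕ → Type*}
  [∀ v w, AddCommMonoid (X v w)] [∀ v w, Module k (X v w)]
  [∀ v w, AddCommMonoid (Y v w)] [∀ v w, Module k (Y v w)]

/-- The laws of a double mixed complex are inherited along injective maps. -/
theorem IsDoubleMixedComplex.of_injective {b : ∀ v w, X (v + 1) w →ₗ[k] X v w}
    {β : ∀ v w, X v (w + 1) →ₗ[k] X v w} {B : ∀ v w, X v w →ₗ[k] X v (w + 1)}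
    {b' : ∀ v w, Y (v + 1) w →ₗ[k] Y v w} {β' : ∀ v w, Y v (w + 1) →ₗ[k] Y v w}
    {B' : ∀ v w, Y v w →ₗ[k] Y v (w + 1)} (h : IsDoubleMixedComplex b' β' B')
    (f : ∀ v w, X v w →ₗ[k] Y v w) (hf : ∀ v w, Function.Injective (f v w))
    (hb : ∀ v w x, b' v w (f (v + 1) w x) = f v w (b v w x))
    (hβ : ∀ v w x, β' v w (f v (w + 1) x) = f v w (β v w x))
    (hB : ∀ v w x, B' v w (f v w x) = f v (w + 1) (B v w x)) : IsDoubleMixedComplex b β B where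
  b_b v w x := hf _ _ (by rw [← hb, ← hb, h.b_b, map_zero])
  β_β v w x := hf _ _ (by rw [← hβ, ← hβ, h.β_β, map_zero])
  B_B v w x := hf _ _ (by rw [← hB, ← hB, h.B_B, map_zero])
  β_b v w x := hf _ _ (by rw [map_add, ← hβ, ← hb, ← hb, ← hβ, h.β_b, map_zero])
  β_B v w x := hf _ _ (by rw [map_add, ← hβ, ← hB, ← hB, ← hβ, h.β_B, map_zero])
  β_B_zero v x := hf _ _ (by rw [← hβ, ← hB, h.β_B_zero, map_zero])
  b_B v w x := hf _ _ (by rw [map_add, ← hb, ← hB, ← hB, ← hb, h.b_B, map_zero])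

end Transfer

end

end CleftExt

/-! ### The main theorem -/

theorem mainTheorem4 {k A M : Type*} [CommRing k] [Algebra ℚ k] [Ring A] [Algebra k A]
    [AddCommGroup M] [Module k M] [Module A M] [Module Aᵐᵒᵖ M] [SMulCommClass A Aᵐᵒᵖ M]
    [IsScalarTower k A M] [IsScalarTower k Aᵐᵒᵖ M]
    (K : Subalgebra k A) (D : CleftExt.BimoduleMul k A M) :
    CleftExt.IsDoubleMixedComplex (k := k) (X := CleftExt.TildeX M K) (CleftExt.bTilde M K)
        (fun v w => CleftExt.dTilde K D v w + CleftExt.xiTilde K D v w) (CleftExt.BTilde M K) ∧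
      (∀ v w, IsCompl (LinearMap.ker ((CleftExt.karoubi K D v w - 1) ^ 2))
        (LinearMap.range ((CleftExt.karoubi K D v w - 1) ^ 2))) ∧
      ∃ (hb : ∀ v w, ∀ z ∈ CleftExt.harmonicPart K D (v + 1) w,
            CleftExt.bDD M K v w z ∈ CleftExt.harmonicPart K D v w)
        (hd : ∀ v w, ∀ z ∈ CleftExt.harmonicPart K D v (w + 1),
            CleftExt.dDD K D v w z ∈ CleftExt.harmonicPart K D v w)
        (hB : ∀ v w, ∀ z ∈ CleftExt.harmonicPart K D v w,
            CleftExt.BDD M K v w z ∈ CleftExt.harmonicPart K D v (w + 1))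
        (hΨ : ∀ v w z, CleftExt.Psi K D v w z ∈ CleftExt.harmonicPart K D v w),
        CleftExt.IsDoubleMixedComplex (k := k) (X := fun v w => CleftExt.harmonicPart K D v w)
            (fun v w => (CleftExt.bDD M K v w).restrict (hb v w))
            (fun v w => (CleftExt.dDD K D v w).restrict (hd v w))
            (fun v w => (CleftExt.BDD M K v w).restrict (hB v w)) ∧
          CleftExt.IsDoubleMixedIso (k := k) (X := CleftExt.TildeX M K)
            (Y := fun v w => CleftExt.harmonicPart K D v w)
            (CleftExt.bTilde M K)
            (fun v w => CleftExt.dTilde K D v w + CleftExt.xiTilde K D v w)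
            (CleftExt.BTilde M K)
            (fun v w => (CleftExt.bDD M K v w).restrict (hb v w))
            (fun v w => (CleftExt.dDD K D v w).restrict (hd v w))
            (fun v w => (CleftExt.BDD M K v w).restrict (hB v w))
            (fun v w => (CleftExt.Psi K D v w).codRestrict _ (hΨ v w)) := by
  have hDD := CleftExt.isDoubleMixedComplex_dDotX (K := K) D
  have hmem := fun v w => CleftExt.Psi_mem (K := K) D v w
  -- Stability needs no commutation with κ̈: every harmonic element is a value of Ψ, and Ψ
  -- intertwines the operators.
  have hb : ∀ v w, ∀ z ∈ CleftExt.harmonicPart K D (v + 1) w,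
      CleftExt.bDD M K v w z ∈ CleftExt.harmonicPart K D v w := by
    intro v w z hz
    obtain ⟨y, rfl⟩ := CleftExt.exists_Psi_eq D hz
    rw [CleftExt.bDD_Psi]; exact hmem _ _ _
  have hd : ∀ v w, ∀ z ∈ CleftExt.harmonicPart K D v (w + 1),
      CleftExt.dDD K D v w z ∈ CleftExt.harmonicPart K D v w := by
    intro v w z hz
    obtain ⟨y, rfl⟩ := CleftExt.exists_Psi_eq D hz
    rw [CleftExt.dDD_Psi]; exact hmem _ _ _
  have hB : ∀ v w, ∀ z ∈ CleftExt.harmonicPart K D v w,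
      CleftExt.BDD M K v w z ∈ CleftExt.harmonicPart K D v (w + 1) := by
    intro v w z hz
    obtain ⟨y, rfl⟩ := CleftExt.exists_Psi_eq D hz
    rw [CleftExt.BDD_Psi]; exact hmem _ _ _
  -- The laws for X̃, including those that involve ξ̄, are inherited from Ẍ along the injective Ψ.
  refine ⟨hDD.of_injective (CleftExt.Psi K D) (CleftExt.Psi_injective D) (CleftExt.bDD_Psi D)
    (CleftExt.dDD_Psi D) (CleftExt.BDD_Psi D), CleftExt.isCompl_karoubi D, hb, hd, hB, hmem, ?_, ?_⟩
  · exact hDD.of_injective (fun v w => (CleftExt.harmonicPart K D v w).subtype)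
      (fun v w => Subtype.val_injective) (fun _ _ _ => rfl) (fun _ _ _ => rfl) (fun _ _ _ => rfl)
  · refine ⟨fun v w => ⟨fun x y h => CleftExt.Psi_injective D v w (congrArg Subtype.val h), ?_⟩,
      fun v w x => Subtype.ext (CleftExt.bDD_Psi D v w x),
      fun v w x => Subtype.ext (CleftExt.dDD_Psi D v w x),
      fun v w x => Subtype.ext (CleftExt.BDD_Psi D v w x)⟩
    rintro ⟨z, hz⟩
    obtain ⟨y, hy⟩ := CleftExt.exists_Psi_eq D hz
    exact ⟨y, Subtype.ext hy⟩
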